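/- **Theorem 2.1.** Let $\rho>0$ and $b_n=\frac1{n+1}$. Consider a processor sharing $M/M/1$ queue with balking, with service rate $1$ and arrival rate $\rho$, and a tagged customer that joins $n\ge 0$ others at time $0$. While the tagged customer is in the system together with $k$ others, each of the $k+1$ customers is served at rate $\frac1{k+1}$, and an arriving customer enters with probability $b_k$ and balks with probability $1-b_k$. Thus the number of others goes from $k$ to $k+1$ at rate $\rho b_k$ and from $k$ to $k-1$ at rate $\frac{k}{k+1}$, and the tagged customer leaves at rate $\frac1{k+1}$. Let $\mathcal V_n$ be the sojourn time of the tagged customer and $\mathbf V_n(t)=\mathrm{Prob}[\mathcal V_n>t]$. Then $\mathbf V_n$ is differentiable on $[0,\infty)$ (one-sidedly at $t=0$), and the conditional sojourn time density $p_n(t)=-\mathbf V_n'(t)$ satisfies, for all $n\ge0$ and $t\ge0$, $$p_n(t)=\sum_{m=1}^\infty C_m(\nu_m)\,\phi_m(n,\nu_m)\,e^{\nu_m t}+\sum_{m=1}^\infty C_m(\widetilde\nu_m)\,\phi_m(n,\widetilde\nu_m)\,e^{\widetilde\nu_m t},$$ where both series converge absolutely and $$\nu_m=-1+\frac1{2m}\Big[-\rho+\sqrt{\rho^2+4m\rho}\Big],\qquad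 \widetilde\nu_m=-1+\frac1{2m}\Big[-\rho-\sqrt{\rho^2+4m\rho}\Big],$$ $$C_m(\nu)=\frac{m^{m-1}}{m!}\,\frac{\nu}{\nu-1}\,e^{-m},\qquad \phi_m(n,\nu)=n!\Big(\frac{\nu+1}{-\rho}\Big)^n L_n^{(m-1-n)}\Big(\frac{\rho}{(\nu+1)^2}\Big),$$ and $L_n^{(\alpha)}(x)=\sum_{k=0}^n(-1)^k\binom{n+\alpha}{n-k}\frac{x^k}{k!}$ is the generalized Laguerre polynomial, with $\binom{\beta}{j}=\beta(\beta-1)\cdots(\beta-j+1)/j!$ for real $\beta$. -/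

import Mathlib

open MeasureTheory ProbabilityTheory Set
open scoped ENNReal Nat

namespace BalkingPS

/-!
## The tagged customer in the processor-sharing M/M/1 queue with balking

Service rate `1`, arrival rate `ρ`.  While the tagged customer shares the system with `n` others,
an arriving customer enters with probability `b n` and balks otherwise.  The server is busy as long
as the tagged customer is present, so that the next arrival and the next service completion occur
after independent exponential times with parameters `ρ` and `1`.  Each of the `n + 1` customers
present is served at rate `1 / (n + 1)` and has an exponential remaining requirement with parameter
`1`, so that the one who leaves at a service completion is uniformly distributed among them.
Exponential times are memoryless, so both clocks are restarted at each event.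

Thus the number of others is a Markov process with rates `n → n + 1` : `ρ * b n`,
`n → n - 1` : `n / (n + 1)`, and the tagged customer leaves at rate `1 / (n + 1)`; the tails `V n`
of the sojourn times solve
`(V n)' = n / (n + 1) * V (n - 1) - (1 + ρ * b n) * V n + ρ * b n * V (n + 1)`, `V n 0 = 1`.
-/

/-- The law of the randomness used up to one event: the (independent) time to the next arrival,
time to the next service completion, and a uniform variable that decides whether the arriving
customer enters, or which of the customers leaves. -/
noncomputable def eventLaw (ρ : ℝ) : Measure (ℝ × ℝ × ℝ) :=
  (expMeasure ρ).prod ((expMeasure 1).prod (volume.restrict (Icc (0 : ℝ) 1)))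

/-- `ξ k = (a, s, u)` is the randomness for the `k`-th event; the triples are independent and
identically distributed with law `eventLaw ρ`. -/
structure IsQueueInput {Ω : Type*} [MeasurableSpace Ω] (ρ : ℝ) (P : Measure Ω)
    (ξ : ℕ → Ω → ℝ × ℝ × ℝ) : Prop where
  hasLaw : ∀ k, HasLaw (ξ k) (eventLaw ρ) P
  indep : iIndepFun ξ P

open Classical in
/-- One event.  The state `some n` means that the tagged customer is present with `n` others, and
`none` means that the tagged customer has left.  If the arrival comes first, the arriving customer
enters if `u < b n`; otherwise a service is completed, and the tagged customer is the one who
leaves if `u < 1 / (n + 1)`. -/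
noncomputable def step (b : ℕ → ℝ) : Option ℕ → ℝ × ℝ × ℝ → Option ℕ
  | none, _ => none
  | some n, (a, s, u) =>
    if a < s then
      if u < b n then some (n + 1) else some n
    else
      if u < 1 / ((n : ℝ) + 1) then none else some (n - 1)

/-- The state after `k` events, for a tagged customer that joins `n` others at time `0`. -/
noncomputable def state {Ω : Type*} (b : ℕ → ℝ) (ξ : ℕ → Ω → ℝ × ℝ × ℝ) (n : ℕ) :
    ℕ → Ω → Option ℕ
  | 0, _ => some n
  | k + 1, ω => step b (state b ξ n k ω) (ξ k ω)

/-- The sojourn time of a tagged customer that joins `n` others: the total length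
`min a s` of the inter-event periods during which the tagged customer is present. -/
noncomputable def sojournTime {Ω : Type*} (b : ℕ → ℝ) (ξ : ℕ → Ω → ℝ × ℝ × ℝ) (n : ℕ) (ω : Ω) :
    ℝ≥0∞ :=
  ∑' k, if (state b ξ n k ω).isSome then
    ENNReal.ofReal (min (ξ k ω).1 (ξ k ω).2.1) else 0

/-- The tail `V n t = Prob[sojourn time > t]`. -/
noncomputable def sojournTail {Ω : Type*} [MeasurableSpace Ω] (P : Measure Ω) (b : ℕ → ℝ)
    (ξ : ℕ → Ω → ℝ × ℝ × ℝ) (n : ℕ) (t : ℝ) : ℝ :=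
  P.real {ω | ENNReal.ofReal t < sojournTime b ξ n ω}

/-- The conditional sojourn time density `p n t = - (V n)' t`, `t ≥ 0` (one-sided derivative at
`t = 0`). -/
noncomputable def sojournDensity {Ω : Type*} [MeasurableSpace Ω] (P : Measure Ω) (b : ℕ → ℝ)
    (ξ : ℕ → Ω → ℝ × ℝ × ℝ) (n : ℕ) (t : ℝ) : ℝ :=
  -derivWithin (sojournTail P b ξ n) (Ici 0) t

/-- The probability `b n = 1 / (n + 1)` of not balking. -/
noncomputable def joinProb (n : ℕ) : ℝ := 1 / ((n : ℝ) + 1)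

/-! ## The ingredients of the spectral representation -/

/-- The generalized Laguerre polynomial
`L_n^(α)(x) = ∑_{k=0}^n (-1)^k * binom (n + α) (n - k) * x^k / k!`, for arbitrary real `α`. -/
noncomputable def laguerre (n : ℕ) (α x : ℝ) : ℝ :=
  ∑ k ∈ Finset.range (n + 1), (-1) ^ k * Ring.choose ((n : ℝ) + α) (n - k) * (x ^ k / (k ! : ℝ))

/-- `ν_m = -1 + (-ρ + √(ρ² + 4 m ρ)) / (2 m)`. -/
noncomputable def nu (ρ : ℝ) (m : ℕ) : ℝ :=
  -1 + 1 / (2 * (m : ℝ)) * (-ρ + √(ρ ^ 2 + 4 * m * ρ))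

/-- `ν̃_m = -1 + (-ρ - √(ρ² + 4 m ρ)) / (2 m)`. -/
noncomputable def nuTilde (ρ : ℝ) (m : ℕ) : ℝ :=
  -1 + 1 / (2 * (m : ℝ)) * (-ρ - √(ρ ^ 2 + 4 * m * ρ))

/-- `C_m(ν) = m^(m-1) / m! * ν / (ν - 1) * e^(-m)`, for `m ≥ 1`. -/
noncomputable def coeff (m : ℕ) (ν : ℝ) : ℝ :=
  (m : ℝ) ^ (m - 1) / (m ! : ℝ) * (ν / (ν - 1)) * Real.exp (-(m : ℝ))

/-- `φ_m(n, ν) = n! * ((ν + 1) / (-ρ))^n * L_n^(m-1-n) (ρ / (ν + 1)²)`. -/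
noncomputable def phi (ρ : ℝ) (m n : ℕ) (ν : ℝ) : ℝ :=
  (n ! : ℝ) * ((ν + 1) / (-ρ)) ^ n * laguerre n ((m : ℝ) - 1 - n) (ρ / (ν + 1) ^ 2)

/-- The term `C_m(ν) φ_m(n, ν) e^(ν t)`. -/
noncomputable def spectralTerm (ρ : ℝ) (n : ℕ) (t : ℝ) (m : ℕ) (ν : ℝ) : ℝ :=
  coeff m ν * phi ρ m n ν * Real.exp (ν * t)

end BalkingPS

/-!
## Why the density is the spectral series

Put `x = ν + 1`. The numbers `x` that belong to the index `m` are the two roots of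
`m * x ^ 2 = ρ * (1 - x)`.

*The queue.* Restarting both clocks at each event makes the events a Poisson process of rate
`1 + ρ`, independent of the chain of states, whose transition operator (killed when the tagged
customer leaves) is `stepOp`. The sojourn time exceeds `t` exactly if the tagged customer is present
during the inter-event period that contains `t`, so that
`V n t = ∑ k, (stepOp ^ k 1) n * e ^ (-(1 + ρ) t) * ((1 + ρ) t) ^ k / k!` (`sojournTail_eq`). This
series can be differentiated term by term, and one event decreases the survival probability by
`h / (1 + ρ)`, `h n = 1 / (n + 1)`; hence the density is the same mixture with `h` in the place of
`1`.

*The spectral side.* The generating function `(1 + w) ^ (m - 1) * exp (-y w)` of the Laguerre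
polynomials shows that `φ_m(n, ν)` is a polynomial `eigenPoly ρ x n` in `x`, and that in `n` it is
an eigenfunction of `stepOp` for the eigenvalue `(x + ρ) / (1 + ρ)`. So the spectral series is the
density as soon as it has the right initial values, `∑ C_m(ν) φ_m(n, ν) = 1 / (n + 1)`
(`spectralFunctional_eigenPoly`).

*The initial values.* With `a = ρ (u - u ^ 2)`, the resolvent of the generator, applied to `h`, is
`∫ τ in 0..1, (τ + (1 - τ) u) ^ n * (τ e ^ (1 - τ)) ^ a` (`resolventIntegral_rec`). For `n = 0` it
has the expansion `∑ m, m ^ m e ^ (-m) / m! / (m + a)`, by the series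
`∑ m ^ m / m! * (τ e ^ (-τ)) ^ m = 1 / (1 - τ)` of the tree function (`hasSum_tree`,
`hasSum_borelWeight_div`), and its partial fractions are the `n = 0` coordinate
`∑ C_m(ν) / (1 - u x)` of the resolvent of the spectral series. Both resolvents satisfy the same
three-term recurrence in `n`, except that the inhomogeneous term of the second one contains the
unknown initial values; these do not depend on `u`. Since both stay bounded when `u → 0`, the
recurrence determines the initial values and the next coordinate at once.
-/

namespace BalkingPS

/-! ### The eigenfunctions as polynomials in `x = ν + 1` -/

/-- The solution `f` of `ρ * f (n + 1) = ((n + 1) * x + ρ) * f n - n * f (n - 1)`, `f 0 = 1`, that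
is, the eigenfunction for the eigenvalue `x - 1` of the generator of the tagged customer's
process. -/
noncomputable def eigenPoly (ρ x : ℝ) : ℕ → ℝ
  | 0 => 1
  | 1 => (x + ρ) / ρ
  | n + 2 => (((n + 2 : ℝ) * x + ρ) * eigenPoly ρ x (n + 1) - (n + 1) * eigenPoly ρ x n) / ρ

theorem eigenPoly_rec {ρ : ℝ} (hρ : ρ ≠ 0) (x : ℝ) (n : ℕ) :
    ρ * eigenPoly ρ x (n + 1)
      = ((n + 1 : ℝ) * x + ρ) * eigenPoly ρ x n - n * eigenPoly ρ x (n - 1) := by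
  cases n with
  | zero => simp [eigenPoly]; field_simp
  | succ n => simp [eigenPoly]; field_simp; ring

/-- On a bounded range of `x`, each eigenfunction is bounded. -/
theorem exists_abs_eigenPoly_le (ρ B : ℝ) (n : ℕ) :
    ∃ K : ℝ, 0 ≤ K ∧ ∀ x, |x| ≤ B → |eigenPoly ρ x n| ≤ K := by
  have hc : ∀ n, Continuous (fun x => eigenPoly ρ x n) := by
    intro n
    induction n using Nat.strong_induction_on with
    | _ n ih =>
      match n with
      | 0 => simpa [eigenPoly] using continuous_const
      | 1 => simp only [eigenPoly]; fun_prop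
      | n + 2 =>
        have h1 := ih (n + 1) (by lia)
        have h2 := ih n (by lia)
        simp only [eigenPoly]
        fun_prop
  obtain ⟨K, hK⟩ := (isCompact_Icc (a := -B) (b := B)).exists_bound_of_continuousOn
    (hc n).continuousOn
  exact ⟨max K 0, le_max_right _ _, fun x hx => (hK x (abs_le.1 hx)).trans (le_max_left _ _)⟩

/-- The coefficients of `(1 + w) ^ α * exp (-y * w)`, the generating function of
`n ↦ L_n^(α - n) y`. -/
theorem laguerre_eq_sum (α n : ℕ) (y : ℝ) :
    laguerre n ((α : ℝ) - n) y
      = PowerSeries.coeff n ((1 + PowerSeries.X : PowerSeries ℝ) ^ α *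
          PowerSeries.rescale (-y) (PowerSeries.exp ℝ)) := by
  rw [mul_comm, PowerSeries.coeff_mul,
    Finset.Nat.sum_antidiagonal_eq_sum_range_succ
      (fun i j => PowerSeries.coeff i (PowerSeries.rescale (-y) (PowerSeries.exp ℝ)) *
        PowerSeries.coeff j ((1 + PowerSeries.X : PowerSeries ℝ) ^ α)), laguerre]
  refine Finset.sum_congr rfl fun k _ => ?_
  have h : PowerSeries.coeff (n - k) ((1 + PowerSeries.X : PowerSeries ℝ) ^ α)
      = (α.choose (n - k) : ℝ) := by
    have := Polynomial.coeff_one_add_X_pow ℝ α (n - k)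
    rw [← this, ← Polynomial.coeff_coe]
    simp
  rw [h, add_sub_cancel, Ring.choose_natCast, PowerSeries.coeff_rescale, PowerSeries.coeff_exp]
  rw [neg_pow]
  simp
  ring

/-- The differential equation `(1 + w) * F' = (α - y * (1 + w)) * F` of the generating function,
read off in the coefficients. -/
theorem laguerre_succ (α n : ℕ) (y : ℝ) :
    (n + 1 : ℝ) * laguerre (n + 1) ((α : ℝ) - (n + 1 : ℕ)) y
      = ((α : ℝ) - n - y) * laguerre n ((α : ℝ) - n) y
        - y * (if n = 0 then 0 else laguerre (n - 1) ((α : ℝ) - (n - 1 : ℕ)) y) := by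
  simp only [laguerre_eq_sum]
  set E := PowerSeries.rescale (-y) (PowerSeries.exp ℝ) with hE
  set F : PowerSeries ℝ := (1 + PowerSeries.X) ^ α * E with hF
  have hdE : PowerSeries.derivative ℝ E = PowerSeries.C (-y) * E := by
    ext k
    simp [hE, PowerSeries.coeff_derivative, PowerSeries.coeff_rescale, PowerSeries.coeff_exp,
      Nat.factorial_succ, pow_succ]
    field_simp
  have hode : (1 + PowerSeries.X) * PowerSeries.derivative ℝ F
      = (PowerSeries.C (α : ℝ) + PowerSeries.C (-y) * (1 + PowerSeries.X)) * F := by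
    have h1 : (1 + PowerSeries.X) * PowerSeries.derivative ℝ ((1 + PowerSeries.X) ^ α)
        = PowerSeries.C (α : ℝ) * (1 + PowerSeries.X) ^ α := by
      rw [Derivation.leibniz_pow]
      rcases α with _ | α
      · simp
      · simp [pow_succ]
        ring
    rw [hF, Derivation.leibniz, hdE, smul_eq_mul, smul_eq_mul, mul_add]
    calc _ = (1 + PowerSeries.X) ^ α * (1 + PowerSeries.X) * PowerSeries.C (-y) * E
        + E * ((1 + PowerSeries.X) * PowerSeries.derivative ℝ ((1 + PowerSeries.X) ^ α)) := by ring
      _ = _ := by rw [h1]; ring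
  have hn := congrArg (PowerSeries.coeff n) hode
  rcases n with _ | n
  · simp only [add_mul, one_mul, mul_add, mul_one, map_add, mul_assoc,
      PowerSeries.coeff_C_mul, PowerSeries.coeff_zero_X_mul, PowerSeries.coeff_derivative] at hn
    simp at hn ⊢
    linarith
  · simp only [add_mul, one_mul, mul_add, mul_one, map_add, mul_assoc,
      PowerSeries.coeff_C_mul, PowerSeries.coeff_succ_X_mul, PowerSeries.coeff_derivative] at hn
    rw [if_neg (Nat.succ_ne_zero n), Nat.add_sub_cancel]
    push_cast at hn ⊢
    linarith

/-- If `ν + 1` is a root of `m * x ^ 2 = ρ * (1 - x)`, then `φ_m(·, ν)` is the eigenfunction for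
the eigenvalue `ν`. -/
theorem phi_eq_eigenPoly {ρ : ℝ} (hρ : 0 < ρ) {m : ℕ} {ν : ℝ}
    (hν : ((m : ℝ) + 1) * (ν + 1) ^ 2 = ρ * (1 - (ν + 1))) (n : ℕ) :
    phi ρ (m + 1) n ν = eigenPoly ρ (ν + 1) n := by
  set x := ν + 1 with hx
  have hx0 : x ≠ 0 := by
    rintro h
    rw [h] at hν
    simp at hν
    exact hρ.ne hν
  have hphi : ∀ n, phi ρ (m + 1) n ν
      = (n ! : ℝ) * (x / (-ρ)) ^ n * laguerre n ((m : ℝ) - n) (ρ / x ^ 2) := by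
    intro n
    simp only [phi, ← hx]
    push_cast
    ring_nf
  have hm : (m : ℝ) = ρ / x ^ 2 - ρ / x - 1 := by
    field_simp
    linarith
  have hstep : ∀ n, ρ * phi ρ (m + 1) (n + 1) ν
      = ((n + 1 : ℝ) * x + ρ) * phi ρ (m + 1) n ν - n * phi ρ (m + 1) (n - 1) ν := by
    intro n
    have h := laguerre_succ m n (ρ / x ^ 2)
    simp only [hphi]
    have h2 : ρ * (((n + 1) ! : ℕ) * (x / (-ρ)) ^ (n + 1) *
        laguerre (n + 1) ((m : ℝ) - (n + 1 : ℕ)) (ρ / x ^ 2))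
        = -x * (n ! : ℝ) * (x / (-ρ)) ^ n *
          ((n + 1 : ℝ) * laguerre (n + 1) ((m : ℝ) - (n + 1 : ℕ)) (ρ / x ^ 2)) := by
      rw [Nat.factorial_succ, pow_succ]
      push_cast
      field_simp
    rw [h2, h]
    rcases n with _ | n
    · simp
      rw [hm]
      field_simp
      ring
    · rw [if_neg (Nat.succ_ne_zero n), Nat.factorial_succ]
      simp only [Nat.add_sub_cancel]
      push_cast
      rw [hm, pow_succ]
      field_simp
      ring
  induction n using Nat.strong_induction_on with
  | _ n ih =>
    rcases n with _ | n
    · rw [hphi]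
      simp [laguerre, eigenPoly]
    · have h1 := hstep n
      have h2 := eigenPoly_rec hρ.ne' x n
      rw [ih n (by lia), ih (n - 1) (by lia), ← h2] at h1
      exact mul_left_cancel₀ hρ.ne' h1

theorem nu_root {ρ : ℝ} (hρ : 0 < ρ) (m : ℕ) :
    ((m : ℝ) + 1) * (nu ρ (m + 1) + 1) ^ 2 = ρ * (1 - (nu ρ (m + 1) + 1)) := by
  have hs : √(ρ ^ 2 + 4 * ((m : ℝ) + 1) * ρ) ^ 2 = ρ ^ 2 + 4 * ((m : ℝ) + 1) * ρ :=
    Real.sq_sqrt (by positivity)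
  simp only [nu]
  push_cast
  generalize √(ρ ^ 2 + 4 * ((m : ℝ) + 1) * ρ) = s at hs ⊢
  field_simp
  linear_combination hs

theorem nuTilde_root {ρ : ℝ} (hρ : 0 < ρ) (m : ℕ) :
    ((m : ℝ) + 1) * (nuTilde ρ (m + 1) + 1) ^ 2 = ρ * (1 - (nuTilde ρ (m + 1) + 1)) := by
  have hs : √(ρ ^ 2 + 4 * ((m : ℝ) + 1) * ρ) ^ 2 = ρ ^ 2 + 4 * ((m : ℝ) + 1) * ρ :=
    Real.sq_sqrt (by positivity)
  simp only [nuTilde]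
  push_cast
  generalize √(ρ ^ 2 + 4 * ((m : ℝ) + 1) * ρ) = s at hs ⊢
  field_simp
  linear_combination hs

theorem nu_add_nuTilde (ρ : ℝ) (m : ℕ) :
    (nu ρ (m + 1) + 1) + (nuTilde ρ (m + 1) + 1) = -ρ / ((m : ℝ) + 1) := by
  simp only [nu, nuTilde]
  push_cast
  field_simp
  ring

theorem nu_mul_nuTilde {ρ : ℝ} (hρ : 0 < ρ) (m : ℕ) :
    (nu ρ (m + 1) + 1) * (nuTilde ρ (m + 1) + 1) = -ρ / ((m : ℝ) + 1) := by
  have hs : √(ρ ^ 2 + 4 * ((m : ℝ) + 1) * ρ) ^ 2 = ρ ^ 2 + 4 * ((m : ℝ) + 1) * ρ :=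
    Real.sq_sqrt (by positivity)
  simp only [nu, nuTilde]
  push_cast
  generalize √(ρ ^ 2 + 4 * ((m : ℝ) + 1) * ρ) = s at hs ⊢
  field_simp
  linear_combination -hs

theorem le_one_of_root {ρ : ℝ} (hρ : 0 < ρ) {m : ℕ} {x : ℝ}
    (hx : ((m : ℝ) + 1) * x ^ 2 = ρ * (1 - x)) : x ≤ 1 := by
  have : 0 ≤ ρ * (1 - x) := hx ▸ by positivity
  linarith [nonneg_of_mul_nonneg_right this hρ]

theorem abs_le_of_root {ρ : ℝ} (hρ : 0 < ρ) {m : ℕ} {x : ℝ}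
    (hx : ((m : ℝ) + 1) * x ^ 2 = ρ * (1 - x)) : |x| ≤ 1 + ρ := by
  have h1 := le_one_of_root hρ hx
  have h2 : x ^ 2 ≤ ρ * (1 - x) := by
    rw [← hx]
    nlinarith [sq_nonneg x, Nat.cast_nonneg (α := ℝ) m]
  rw [abs_le]
  constructor <;> nlinarith

/-! ### The tree function and the Borel weights -/

/-- An `N`-th finite difference of `m ↦ m ^ N`. -/
theorem sum_antidiagonal_pow_div_factorial (N : ℕ) :
    ∑ p ∈ Finset.HasAntidiagonal.antidiagonal N,
      ((p.1 : ℝ) ^ p.1 / p.1 !) * ((-(p.1 : ℝ)) ^ p.2 / p.2 !) = 1 := by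
  have h := congrFun (fwdDiff_iter_eq_factorial (R := ℝ) (n := N)) 0
  rw [fwdDiff_iter_eq_sum_shift] at h
  rw [Finset.Nat.sum_antidiagonal_eq_sum_range_succ
    (fun i j => ((i : ℝ) ^ i / i !) * ((-(i : ℝ)) ^ j / j !))]
  have h2 : ∀ k ∈ Finset.range (N + 1), ((k : ℝ) ^ k / k !) * ((-(k : ℝ)) ^ (N - k) / (N - k)!)
      = (N ! : ℝ)⁻¹ * (((-1 : ℤ) ^ (N - k) * N.choose k) • ((0 : ℝ) + k • (1 : ℝ)) ^ N) := by
    intro k hk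
    have hk' : k ≤ N := Nat.lt_succ_iff.1 (Finset.mem_range.1 hk)
    have hc : (N.choose k : ℝ) = N ! / (k ! * (N - k)!) := Nat.cast_choose ℝ hk'
    have hp : (k : ℝ) ^ N = (k : ℝ) ^ k * (k : ℝ) ^ (N - k) := by
      rw [← pow_add, Nat.add_sub_cancel' hk']
    rw [zsmul_eq_mul, zero_add, nsmul_one, hp, neg_pow]
    push_cast
    rw [hc]
    field_simp
  rw [Finset.sum_congr rfl h2, ← Finset.mul_sum, h]
  simp
  field_simp

theorem pow_self_div_factorial_le (m : ℕ) : (m : ℝ) ^ m / m ! ≤ Real.exp 1 ^ m := by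
  rw [← Real.exp_nat_mul, mul_one]
  exact Real.pow_div_factorial_le_exp _ m.cast_nonneg m

/-- For small `τ` the double series that results from expanding `exp (-m * τ)` converges absolutely,
and summation along the antidiagonals gives the geometric series. -/
theorem hasSum_tree_of_small {τ : ℝ} (h0 : 0 ≤ τ) (h1 : τ < 1 / 8) :
    HasSum (fun m : ℕ => (m : ℝ) ^ m / m ! * (τ * Real.exp (-τ)) ^ m) (1 / (1 - τ)) := by
  set f : ℕ × ℕ → ℝ := fun p =>
    ((p.1 : ℝ) ^ p.1 / p.1 ! * τ ^ p.1) * ((-(p.1 * τ)) ^ p.2 / p.2 !) with hf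
  have hexp : ∀ y : ℝ, HasSum (fun j : ℕ => y ^ j / j !) (Real.exp y) := fun y => by
    rw [Real.exp_eq_exp_ℝ]
    exact NormedSpace.expSeries_div_hasSum_exp y
  have hsum : Summable f := by
    have hnn : ∀ p : ℕ × ℕ, ‖f p‖ = ((p.1 : ℝ) ^ p.1 / p.1 ! * τ ^ p.1) *
        ((p.1 * τ) ^ p.2 / p.2 !) := by
      intro p
      rw [hf, norm_mul, norm_div, norm_pow (-_), norm_neg, Real.norm_of_nonneg (by positivity),
        Real.norm_of_nonneg (by positivity : (0:ℝ) ≤ p.1 * τ), Real.norm_of_nonneg (by positivity)]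
    refine Summable.of_norm ?_
    rw [summable_prod_of_nonneg (fun _ => norm_nonneg _)]
    simp only [hnn]
    refine ⟨fun m => ((hexp _).mul_left _).summable, ?_⟩
    simp only [fun m : ℕ => ((hexp (m * τ)).mul_left ((m : ℝ) ^ m / m ! * τ ^ m)).tsum_eq]
    -- The row sums of absolute values are at most `(e * τ * e ^ τ) ^ m`.
    have hr : Real.exp 1 * τ * Real.exp τ < 1 := by
      have e1 := Real.exp_one_lt_d9
      have e2 : Real.exp τ ≤ Real.exp 1 := Real.exp_le_exp.2 (by linarith)
      have e3 := Real.exp_pos τ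
      calc Real.exp 1 * τ * Real.exp τ ≤ 2.7182818286 * (1 / 8) * 2.7182818286 := by
            gcongr
            exact e2.trans e1.le
        _ < 1 := by norm_num
    refine Summable.of_nonneg_of_le (fun m => by positivity) (fun m => ?_)
      (summable_geometric_of_lt_one (by positivity) hr)
    rw [mul_pow, mul_pow, Real.exp_nat_mul]
    gcongr
    exact pow_self_div_factorial_le m
  have hrow := hsum.hasSum.prod_fiberwise (fun m => (hexp (-(m * τ))).mul_left
    ((m : ℝ) ^ m / m ! * τ ^ m))
  have hdiag : HasSum (fun N : ℕ => τ ^ N) (∑' p, f p) := by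
    have h2 : HasSum (f ∘ Finset.HasAntidiagonal.sigmaAntidiagonalEquivProd) (∑' p, f p) :=
      (Equiv.hasSum_iff _).2 hsum.hasSum
    refine (h2.sigma (fun N => hasSum_fintype _)).congr_fun fun N => ?_
    rw [← mul_one (τ ^ N), ← sum_antidiagonal_pow_div_factorial N, Finset.mul_sum,
      ← Finset.sum_coe_sort]
    refine Finset.sum_congr rfl fun p _ => ?_
    obtain ⟨p, hp⟩ := p
    have : p.1 + p.2 = N := Finset.HasAntidiagonal.mem_antidiagonal.1 hp
    simp only [hf, Function.comp, Finset.HasAntidiagonal.sigmaAntidiagonalEquivProd_apply]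
    rw [← this, pow_add, ← neg_mul, mul_pow]
    ring
  have hval : ∑' p, f p = 1 / (1 - τ) := by
    rw [hdiag.unique (hasSum_geometric_of_lt_one h0 (by linarith)), one_div]
  rw [hval] at hrow
  refine hrow.congr_fun fun m => ?_
  rw [mul_pow, ← Real.exp_nat_mul]
  ring_nf

theorem mul_exp_neg_lt {τ : ℝ} (h1 : τ ≠ 1) : τ * Real.exp (-τ) < Real.exp (-1) := by
  have h : τ < Real.exp (τ - 1) := by
    have := Real.add_one_lt_exp (x := τ - 1) (sub_ne_zero.2 h1)
    linarith
  calc τ * Real.exp (-τ) < Real.exp (τ - 1) * Real.exp (-τ) := by gcongr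
    _ = Real.exp (-1) := by rw [← Real.exp_add]; ring_nf

/-- The series of the derivative of the tree function, `∑ m ^ m / m! * y ^ m = 1 / (1 - τ)` at
`y = τ * exp (-τ)`. For small `τ` it is a rearrangement; both sides are analytic in
`τ ∈ (0, 1)`. -/
theorem hasSum_tree {τ : ℝ} (h0 : 0 < τ) (h1 : τ < 1) :
    HasSum (fun m : ℕ => (m : ℝ) ^ m / m ! * (τ * Real.exp (-τ)) ^ m) (1 / (1 - τ)) := by
  set c : ℕ → ℝ := fun m => (m : ℝ) ^ m / m ! with hc
  set p := FormalMultilinearSeries.ofScalars ℝ c with hp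
  have hle : ENNReal.ofReal (Real.exp (-1)) ≤ p.radius := by
    refine p.le_radius_of_bound 1 (r := Real.toNNReal (Real.exp (-1))) fun n => ?_
    rw [Real.coe_toNNReal _ (Real.exp_pos _).le, FormalMultilinearSeries.ofScalars_norm]
    rw [Real.norm_of_nonneg (by positivity)]
    calc c n * Real.exp (-1) ^ n ≤ Real.exp 1 ^ n * Real.exp (-1) ^ n := by
          gcongr
          exact pow_self_div_factorial_le n
      _ = 1 := by rw [← mul_pow, ← Real.exp_add]; simp
  have hpos : 0 < p.radius := lt_of_lt_of_le (by simpa using Real.exp_pos _) hle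
  have hfs := p.hasFPowerSeriesOnBall hpos
  have hmem : ∀ τ ∈ Ioo (0 : ℝ) 1, τ * Real.exp (-τ) ∈ Metric.eball (0 : ℝ) p.radius := by
    intro τ hτ
    refine Metric.eball_subset_eball hle ?_
    rw [Metric.mem_eball, edist_dist, dist_zero_right, Real.norm_of_nonneg
      (mul_nonneg hτ.1.le (Real.exp_pos _).le)]
    exact (ENNReal.ofReal_lt_ofReal_iff (Real.exp_pos _)).2 (mul_exp_neg_lt hτ.2.ne)
  have hs : ∀ τ ∈ Ioo (0 : ℝ) 1,
      HasSum (fun m : ℕ => c m * (τ * Real.exp (-τ)) ^ m) (p.sum (τ * Real.exp (-τ))) := by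
    intro τ hτ
    have := hfs.hasSum (hmem τ hτ)
    simpa [hp, mul_comm] using this
  have hA : AnalyticOnNhd ℝ (fun τ => p.sum (τ * Real.exp (-τ))) (Ioo 0 1) := by
    intro τ hτ
    have h1 : AnalyticAt ℝ p.sum (τ * Real.exp (-τ)) :=
      hfs.analyticAt_of_mem (hmem τ hτ)
    have h2 : AnalyticAt ℝ (fun τ => τ * Real.exp (-τ)) τ := by fun_prop
    exact h1.comp_of_eq h2 rfl
  have hB : AnalyticOnNhd ℝ (fun τ : ℝ => 1 / (1 - τ)) (Ioo 0 1) := by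
    intro τ hτ
    have : 1 - τ ≠ 0 := by have := hτ.2; linarith
    fun_prop (disch := assumption)
  have heq := hA.eqOn_of_preconnected_of_eventuallyEq hB isPreconnected_Ioo
    (z₀ := 1 / 16) (by norm_num) (by
      filter_upwards [Ioo_mem_nhds (show (0 : ℝ) < 1 / 16 by norm_num)
        (show (1 / 16 : ℝ) < 1 / 8 by norm_num)] with τ hτ
      exact (hs τ ⟨hτ.1, hτ.2.trans (by norm_num)⟩).unique (hasSum_tree_of_small hτ.1.le hτ.2))
  have := hs τ ⟨h0, h1⟩
  rwa [show p.sum (τ * Real.exp (-τ)) = 1 / (1 - τ) from heq ⟨h0, h1⟩] at this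

/-- `τ ↦ τ * exp (1 - τ)`, which maps `[0, 1]` increasingly onto `[0, 1]`. -/
noncomputable def treeVar (τ : ℝ) : ℝ := τ * Real.exp (1 - τ)

theorem continuous_treeVar : Continuous treeVar := by unfold treeVar; fun_prop

theorem treeVar_pos {τ : ℝ} (h : 0 < τ) : 0 < treeVar τ := mul_pos h (Real.exp_pos _)

theorem treeVar_nonneg {τ : ℝ} (h : 0 ≤ τ) : 0 ≤ treeVar τ := mul_nonneg h (Real.exp_pos _).le

theorem treeVar_le_one (τ : ℝ) : treeVar τ ≤ 1 := by
  have h : τ ≤ Real.exp (τ - 1) := by linarith [Real.add_one_le_exp (τ - 1)]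
  calc treeVar τ ≤ Real.exp (τ - 1) * Real.exp (1 - τ) := by unfold treeVar; gcongr
    _ = 1 := by rw [← Real.exp_add]; simp

theorem treeVar_zero : treeVar 0 = 0 := by simp [treeVar]

theorem treeVar_one : treeVar 1 = 1 := by simp [treeVar]

theorem continuous_treeVar_rpow {a : ℝ} (ha : 0 ≤ a) : Continuous fun τ => treeVar τ ^ a :=
  continuous_treeVar.rpow_const fun _ => Or.inr ha

theorem hasDerivAt_treeVar (τ : ℝ) : HasDerivAt treeVar (Real.exp (1 - τ) * (1 - τ)) τ := by
  have h := (hasDerivAt_id τ).mul (((hasDerivAt_id τ).const_sub 1).exp)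
  refine h.congr_deriv ?_
  simp
  ring

theorem hasDerivAt_treeVar_rpow {τ : ℝ} (hτ : 0 < τ) (a : ℝ) :
    HasDerivAt (fun τ => treeVar τ ^ a) (a * treeVar τ ^ a * ((1 - τ) / τ)) τ := by
  refine ((hasDerivAt_treeVar τ).rpow_const (Or.inl (treeVar_pos hτ).ne')).congr_deriv ?_
  rw [Real.rpow_sub_one (treeVar_pos hτ).ne']
  unfold treeVar
  have := Real.exp_pos (1 - τ)
  field_simp

/-- The Borel weights `m ^ (m - 1) * e ^ (-m) / m!`, shifted to `m + 1`, sum to `1`: the case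
`a = 0` of `hasSum_borelWeight_div`. -/
noncomputable def borelWeight (m : ℕ) : ℝ :=
  ((m + 1 : ℕ) : ℝ) ^ m / ((m + 1)! : ℝ) * Real.exp (-((m + 1 : ℕ) : ℝ))

theorem borelWeight_nonneg (m : ℕ) : 0 ≤ borelWeight m := by unfold borelWeight; positivity

theorem hasSum_borelWeight_treeVar {τ : ℝ} (h0 : 0 < τ) (h1 : τ < 1) :
    HasSum (fun m : ℕ =>
      ((m : ℝ) + 1) * borelWeight m * (treeVar τ ^ m * (Real.exp (1 - τ) * (1 - τ)))) 1 := by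
  have h := (hasSum_nat_add_iff' 1).2 (hasSum_tree h0 h1)
  have h3 : (1 / (1 - τ) - ∑ i ∈ Finset.range 1, (i : ℝ) ^ i / i ! * (τ * Real.exp (-τ)) ^ i)
      * ((1 - τ) / τ) = 1 := by
    have : 1 - τ ≠ 0 := by linarith
    simp
    field_simp
    ring
  have h2 := h.mul_right ((1 - τ) / τ)
  rw [h3] at h2
  refine h2.congr_fun fun m => ?_
  have e1 : Real.exp (-((m + 1 : ℕ) : ℝ)) * (Real.exp (1 - τ) ^ m * Real.exp (1 - τ))
      = Real.exp (-τ) ^ (m + 1) := by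
    rw [← pow_succ, ← Real.exp_nat_mul, ← Real.exp_nat_mul, ← Real.exp_add]
    push_cast
    ring_nf
  unfold borelWeight treeVar
  rw [mul_pow, mul_pow, ← e1]
  push_cast
  field_simp
  ring

theorem integral_treeVar_rpow {b : ℝ} (hb : 0 ≤ b) :
    ∫ τ in (0 : ℝ)..1, treeVar τ ^ b * (Real.exp (1 - τ) * (1 - τ)) = 1 / (b + 1) := by
  have h := intervalIntegral.integral_eq_sub_of_hasDerivAt_of_le (a := (0 : ℝ)) (b := 1)
    (f := fun τ => treeVar τ ^ (b + 1) / (b + 1))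
    (f' := fun τ => treeVar τ ^ b * (Real.exp (1 - τ) * (1 - τ))) zero_le_one
    ((continuous_treeVar_rpow (by linarith)).div_const _).continuousOn
    (fun τ hτ => by
      refine ((hasDerivAt_treeVar_rpow hτ.1 (b + 1)).div_const (b + 1)).congr_deriv ?_
      rw [Real.rpow_add_one (treeVar_pos hτ.1).ne']
      have : b + 1 ≠ 0 := by linarith
      have := hτ.1.ne'
      field_simp
      unfold treeVar
      ring)
    (((continuous_treeVar_rpow hb).mul (by fun_prop)).intervalIntegrable _ _)
  rw [h, treeVar_one, treeVar_zero, Real.zero_rpow (by linarith)]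
  simp

/-- Termwise integration of the series of `hasSum_borelWeight_treeVar`, multiplied by
`treeVar τ ^ a`. -/
theorem hasSum_borelWeight_div {a : ℝ} (ha : 0 ≤ a) :
    HasSum (fun m : ℕ => borelWeight m * (((m : ℝ) + 1) / ((m : ℝ) + 1 + a)))
      (∫ τ in (0 : ℝ)..1, treeVar τ ^ a) := by
  set F : ℕ → ℝ → ℝ := fun m τ =>
    ((m : ℝ) + 1) * borelWeight m * (treeVar τ ^ (m + a) * (Real.exp (1 - τ) * (1 - τ))) with hF
  have hcont : ∀ m, Continuous (F m) := fun m =>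
    continuous_const.mul ((continuous_treeVar_rpow (by positivity)).mul (by fun_prop))
  have hint : ∀ m, ∫ τ in (0 : ℝ)..1, F m τ
      = borelWeight m * (((m : ℝ) + 1) / ((m : ℝ) + 1 + a)) := by
    intro m
    rw [hF, intervalIntegral.integral_const_mul, integral_treeVar_rpow (by positivity)]
    rw [show (m : ℝ) + a + 1 = m + 1 + a by ring]
    ring
  have hnn : ∀ m, ∀ τ ∈ Ioo (0 : ℝ) 1, 0 ≤ F m τ := by
    intro m τ hτ
    have := borelWeight_nonneg m
    have := treeVar_pos hτ.1
    have : 0 ≤ 1 - τ := by linarith [hτ.2]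
    positivity
  have hpt : ∀ τ ∈ Ioo (0 : ℝ) 1, HasSum (fun m => F m τ) (treeVar τ ^ a) := by
    intro τ hτ
    have h := (hasSum_borelWeight_treeVar hτ.1 hτ.2).mul_right (treeVar τ ^ a)
    rw [one_mul] at h
    refine h.congr_fun fun m => ?_
    simp only [hF]
    rw [Real.rpow_add (treeVar_pos hτ.1), Real.rpow_natCast]
    ring
  have hioo : ∀ f : ℝ → ℝ, ∫ τ in (0 : ℝ)..1, f τ = ∫ τ in Ioo (0 : ℝ) 1, f τ := fun f => by
    rw [intervalIntegral.integral_of_le zero_le_one, integral_Ioc_eq_integral_Ioo]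
  have hii : ∀ {f : ℝ → ℝ}, Continuous f → IntegrableOn f (Ioo 0 1) := fun hf =>
    (hf.integrableOn_Icc (a := 0) (b := 1)).mono_set Ioo_subset_Icc_self
  -- Summability, which termwise integration presupposes, comes from the partial sums.
  have hbound : ∀ N, ∑ m ∈ Finset.range N, borelWeight m * (((m : ℝ) + 1) / ((m : ℝ) + 1 + a))
      ≤ ∫ τ in (0 : ℝ)..1, treeVar τ ^ a := by
    intro N
    simp only [← hint]
    rw [← intervalIntegral.integral_finsetSum (fun m _ => (hcont m).intervalIntegrable _ _)]
    rw [hioo, hioo]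
    refine setIntegral_mono_on (hii (continuous_finsetSum _ fun m _ => hcont m))
      (hii (continuous_treeVar_rpow ha)) measurableSet_Ioo fun τ hτ => ?_
    exact sum_le_hasSum _ (fun m _ => hnn m τ hτ) (hpt τ hτ)
  have hsum := summable_of_sum_range_le (f := fun m : ℕ =>
    borelWeight m * (((m : ℝ) + 1) / ((m : ℝ) + 1 + a)))
    (fun m => mul_nonneg (borelWeight_nonneg m) (by positivity)) hbound
  have h := hasSum_integral_of_summable_integral_norm (μ := volume.restrict (Ioo (0 : ℝ) 1))
    (F := F) (fun m => hii (hcont m)) (by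
      refine hsum.congr fun m => ?_
      rw [← hint, hioo]
      exact setIntegral_congr_fun measurableSet_Ioo fun τ hτ => by
        simp only [Real.norm_of_nonneg (hnn m τ hτ)])
  have e : ∫ τ in Ioo (0 : ℝ) 1, ∑' m, F m τ = ∫ τ in (0 : ℝ)..1, treeVar τ ^ a := by
    rw [hioo]
    exact setIntegral_congr_fun measurableSet_Ioo fun τ hτ => (hpt τ hτ).tsum_eq
  rw [e] at h
  refine h.congr_fun fun m => ?_
  rw [← hint, hioo]

theorem hasSum_borelWeight : HasSum borelWeight 1 := by
  have h := hasSum_borelWeight_div le_rfl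
  simp only [Real.rpow_zero, intervalIntegral.integral_const, sub_zero, smul_eq_mul, mul_one,
    add_zero] at h
  refine h.congr_fun fun m => ?_
  rw [div_self (by positivity), mul_one]

/-! ### The resolvent as an integral -/

/-- The `n`-th coordinate of the resolvent, applied to the initial density `n ↦ 1 / (n + 1)`; here
`u = 1 / (θ + 1)` for the argument `θ` of the Laplace transform. -/
noncomputable def resolventIntegral (ρ : ℝ) (n : ℕ) (u : ℝ) : ℝ :=
  ∫ τ in (0 : ℝ)..1, (τ + (1 - τ) * u) ^ n * treeVar τ ^ (ρ * (u - u ^ 2))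

theorem abs_resolventIntegral_le {ρ : ℝ} (hρ : 0 ≤ ρ) (n : ℕ) {u : ℝ} (h0 : 0 ≤ u) (h1 : u ≤ 1) :
    |resolventIntegral ρ n u| ≤ 1 := by
  have ha : 0 ≤ ρ * (u - u ^ 2) := mul_nonneg hρ (by nlinarith)
  have h := intervalIntegral.norm_integral_le_of_norm_le_const (a := (0 : ℝ)) (b := 1) (C := 1)
    (f := fun τ => (τ + (1 - τ) * u) ^ n * treeVar τ ^ (ρ * (u - u ^ 2))) (by
      intro τ hτ
      rw [uIoc_of_le zero_le_one] at hτ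
      have hq0 : 0 ≤ τ + (1 - τ) * u := by nlinarith [hτ.1, hτ.2]
      have hq1 : τ + (1 - τ) * u ≤ 1 := by nlinarith [hτ.1, hτ.2]
      have ht := treeVar_nonneg hτ.1.le
      rw [Real.norm_of_nonneg (by positivity)]
      exact mul_le_one₀ (pow_le_one₀ hq0 hq1) (by positivity)
        (Real.rpow_le_one ht (treeVar_le_one τ) ha))
  simpa [resolventIntegral] using h

/-- The resolvent equation: the combination of integrands is the derivative of
`τ * (τ + (1 - τ) * u) ^ n * treeVar τ ^ (ρ * (u - u ^ 2))`. -/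
theorem resolventIntegral_rec {ρ : ℝ} (hρ : 0 ≤ ρ) (n : ℕ) {u : ℝ} (h0 : 0 ≤ u) (h1 : u ≤ 1) :
    (n + 1 : ℝ) * resolventIntegral ρ n u
      - u * (ρ * resolventIntegral ρ (n + 1) u - ρ * resolventIntegral ρ n u
        + n * resolventIntegral ρ (n - 1) u) = 1 := by
  have ha : 0 ≤ ρ * (u - u ^ 2) := mul_nonneg hρ (by nlinarith)
  set a := ρ * (u - u ^ 2) with ha'
  have hY := continuous_treeVar_rpow ha
  have hc : ∀ k : ℕ, Continuous fun τ : ℝ => (τ + (1 - τ) * u) ^ k * treeVar τ ^ a :=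
    fun k => Continuous.mul (by fun_prop) hY
  have hi : ∀ k : ℕ, IntervalIntegrable (fun τ : ℝ => (τ + (1 - τ) * u) ^ k * treeVar τ ^ a)
      volume 0 1 := fun k => (hc k).intervalIntegrable _ _
  have h := intervalIntegral.integral_eq_sub_of_hasDerivAt_of_le (a := (0 : ℝ)) (b := 1)
    (f := fun τ => τ * ((τ + (1 - τ) * u) ^ n * treeVar τ ^ a))
    (f' := fun τ => (n + 1 : ℝ) * ((τ + (1 - τ) * u) ^ n * treeVar τ ^ a)
      - u * (ρ * ((τ + (1 - τ) * u) ^ (n + 1) * treeVar τ ^ a)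
        - ρ * ((τ + (1 - τ) * u) ^ n * treeVar τ ^ a)
        + n * ((τ + (1 - τ) * u) ^ (n - 1) * treeVar τ ^ a))) zero_le_one
    (continuous_id.mul (hc n)).continuousOn
    (fun τ hτ => by
      have hq : HasDerivAt (fun τ : ℝ => τ + (1 - τ) * u) (1 - u) τ := by
        refine ((hasDerivAt_id τ).add (((hasDerivAt_id τ).const_sub 1).mul_const u)).congr_deriv ?_
        ring
      refine ((hasDerivAt_id τ).mul ((hq.pow n).mul
        (hasDerivAt_treeVar_rpow hτ.1 a))).congr_deriv ?_
      have hτ0 := hτ.1.ne'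
      simp only [id, Pi.mul_apply, Pi.pow_apply]
      have e : treeVar τ ^ a * ((1 - τ) / τ) * τ = treeVar τ ^ a * (1 - τ) := by field_simp
      rcases n with _ | n
      · simp only [pow_zero, Nat.cast_zero, zero_add, pow_one, ha'] at e ⊢
        linear_combination a * e
      · simp only [Nat.add_sub_cancel, pow_succ]
        push_cast
        linear_combination (a * (τ + (1 - τ) * u) ^ n * (τ + (1 - τ) * u)) * e)
    ((((hc n).const_mul _).sub ((((hc (n + 1)).const_mul ρ).sub ((hc n).const_mul ρ)).add
      ((hc (n - 1)).const_mul _) |>.const_mul u)).intervalIntegrable _ _)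
  rw [intervalIntegral.integral_sub ((hi n).const_mul _)
      ((((hi (n + 1)).const_mul ρ).sub ((hi n).const_mul ρ)).add ((hi (n - 1)).const_mul _)
        |>.const_mul u),
    intervalIntegral.integral_const_mul, intervalIntegral.integral_const_mul,
    intervalIntegral.integral_add (((hi (n + 1)).const_mul ρ).sub ((hi n).const_mul ρ))
      ((hi (n - 1)).const_mul _),
    intervalIntegral.integral_sub ((hi (n + 1)).const_mul ρ) ((hi n).const_mul ρ),
    intervalIntegral.integral_const_mul, intervalIntegral.integral_const_mul,
    intervalIntegral.integral_const_mul] at h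
  simp only [resolventIntegral, ← ha', h, treeVar_one]
  simp

/-! ### The spectral functional -/

/-- The two families of shifted eigenvalues `ν + 1`, in one notation. -/
structure IsShiftedEigenvalues (ρ : ℝ) (x : ℕ → ℝ) : Prop where
  root : ∀ m : ℕ, ((m : ℝ) + 1) * x m ^ 2 = ρ * (1 - x m)

theorem isShiftedEigenvalues_nu {ρ : ℝ} (hρ : 0 < ρ) :
    IsShiftedEigenvalues ρ fun m => nu ρ (m + 1) + 1 := ⟨nu_root hρ⟩

theorem isShiftedEigenvalues_nuTilde {ρ : ℝ} (hρ : 0 < ρ) :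
    IsShiftedEigenvalues ρ fun m => nuTilde ρ (m + 1) + 1 := ⟨nuTilde_root hρ⟩

/-- The weight `C_m(ν)` of the eigenvalue `ν = x - 1`. -/
noncomputable def spectralWeight (m : ℕ) (x : ℝ) : ℝ := borelWeight m * ((x - 1) / (x - 2))

theorem coeff_eq_spectralWeight (m : ℕ) (ν : ℝ) :
    coeff (m + 1) ν = spectralWeight m (ν + 1) := by
  unfold coeff spectralWeight borelWeight
  rw [Nat.add_sub_cancel, show ν + 1 - 1 = ν by ring, show ν + 1 - 2 = ν - 1 by ring]
  ring

theorem abs_spectralWeight_le {ρ : ℝ} (hρ : 0 < ρ) {x : ℕ → ℝ} (hx : IsShiftedEigenvalues ρ x)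
    (m : ℕ) : |spectralWeight m (x m)| ≤ borelWeight m := by
  have h1 := le_one_of_root hρ (hx.root m)
  have hb := borelWeight_nonneg m
  have h2 : |(x m - 1) / (x m - 2)| ≤ 1 := by
    rw [abs_div, div_le_one (by rw [abs_pos]; linarith), abs_of_nonpos (by linarith),
      abs_of_nonpos (by linarith)]
    linarith
  rw [spectralWeight, abs_mul, abs_of_nonneg hb]
  exact mul_le_of_le_one_right hb h2

/-- Boundedness on the interval that contains all shifted eigenvalues. -/
def BoundedOnSpectrum (ρ : ℝ) (g : ℝ → ℝ) : Prop := ∃ K, 0 ≤ K ∧ ∀ x, |x| ≤ 1 + ρ → |g x| ≤ K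

theorem boundedOnSpectrum_eigenPoly (ρ : ℝ) (n : ℕ) :
    BoundedOnSpectrum ρ fun x => eigenPoly ρ x n := exists_abs_eigenPoly_le ρ (1 + ρ) n

theorem BoundedOnSpectrum.mul {ρ : ℝ} {f g : ℝ → ℝ} (hf : BoundedOnSpectrum ρ f)
    (hg : BoundedOnSpectrum ρ g) : BoundedOnSpectrum ρ fun x => f x * g x := by
  obtain ⟨K, hK, h⟩ := hf
  obtain ⟨M, hM, h'⟩ := hg
  refine ⟨K * M, by positivity, fun x hx => ?_⟩
  rw [abs_mul]
  exact mul_le_mul (h x hx) (h' x hx) (abs_nonneg _) hK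

theorem boundedOnSpectrum_of_continuous {ρ : ℝ} {g : ℝ → ℝ} (hg : Continuous g) :
    BoundedOnSpectrum ρ g := by
  obtain ⟨K, hK⟩ := (isCompact_Icc (a := -(1 + ρ)) (b := 1 + ρ)).exists_bound_of_continuousOn
    hg.continuousOn
  exact ⟨max K 0, le_max_right _ _, fun x hx => (hK x (abs_le.1 hx)).trans (le_max_left _ _)⟩

theorem summable_spectralWeight_mul {ρ : ℝ} (hρ : 0 < ρ) {x : ℕ → ℝ}
    (hx : IsShiftedEigenvalues ρ x) {g : ℝ → ℝ} (hg : BoundedOnSpectrum ρ g) :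
    Summable fun m => spectralWeight m (x m) * g (x m) := by
  obtain ⟨K, hK, h⟩ := hg
  refine Summable.of_norm_bounded (hasSum_borelWeight.summable.mul_right K) fun m => ?_
  rw [norm_mul]
  exact mul_le_mul (abs_spectralWeight_le hρ hx m) (h _ (abs_le_of_root hρ (hx.root m)))
    (norm_nonneg _) (borelWeight_nonneg m)

/-- The functional `g ↦ ∑ C_m(ν) * g (ν + 1)`, the sum extending over all eigenvalues of both
families. -/
noncomputable def spectralFunctional (ρ : ℝ) (g : ℝ → ℝ) : ℝ :=
  (∑' m, spectralWeight m (nu ρ (m + 1) + 1) * g (nu ρ (m + 1) + 1)) +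
    ∑' m, spectralWeight m (nuTilde ρ (m + 1) + 1) * g (nuTilde ρ (m + 1) + 1)

theorem spectralFunctional_add {ρ : ℝ} (hρ : 0 < ρ) {f g : ℝ → ℝ} (hf : BoundedOnSpectrum ρ f)
    (hg : BoundedOnSpectrum ρ g) :
    spectralFunctional ρ (fun x => f x + g x)
      = spectralFunctional ρ f + spectralFunctional ρ g := by
  have h1 := isShiftedEigenvalues_nu hρ
  have h2 := isShiftedEigenvalues_nuTilde hρ
  simp only [spectralFunctional, mul_add]
  rw [(summable_spectralWeight_mul hρ h1 hf).tsum_add (summable_spectralWeight_mul hρ h1 hg),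
    (summable_spectralWeight_mul hρ h2 hf).tsum_add (summable_spectralWeight_mul hρ h2 hg)]
  ring

theorem spectralFunctional_const_mul (ρ c : ℝ) (g : ℝ → ℝ) :
    spectralFunctional ρ (fun x => c * g x) = c * spectralFunctional ρ g := by
  simp only [spectralFunctional, mul_left_comm _ c, tsum_mul_left, mul_add]

theorem BoundedOnSpectrum.const_mul {ρ : ℝ} {g : ℝ → ℝ} (hg : BoundedOnSpectrum ρ g) (c : ℝ) :
    BoundedOnSpectrum ρ fun x => c * g x :=
  (boundedOnSpectrum_of_continuous continuous_const).mul hg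

theorem spectralFunctional_congr {ρ : ℝ} (hρ : 0 < ρ) {f g : ℝ → ℝ}
    (h : ∀ x, |x| ≤ 1 + ρ → f x = g x) : spectralFunctional ρ f = spectralFunctional ρ g := by
  simp only [spectralFunctional, h _ (abs_le_of_root hρ (nu_root hρ _)),
    h _ (abs_le_of_root hρ (nuTilde_root hρ _))]

theorem abs_spectralFunctional_le {ρ : ℝ} (hρ : 0 < ρ) {g : ℝ → ℝ} {K : ℝ}
    (h : ∀ x, |x| ≤ 1 + ρ → |g x| ≤ K) : |spectralFunctional ρ g| ≤ 2 * K := by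
  have key : ∀ x : ℕ → ℝ, IsShiftedEigenvalues ρ x →
      |∑' m, spectralWeight m (x m) * g (x m)| ≤ K := by
    intro x hx
    have := tsum_of_norm_bounded (hasSum_borelWeight.mul_right K) (f := fun m =>
      spectralWeight m (x m) * g (x m)) fun m => by
        rw [norm_mul]
        exact mul_le_mul (abs_spectralWeight_le hρ hx m) (h _ (abs_le_of_root hρ (hx.root m)))
          (norm_nonneg _) (borelWeight_nonneg m)
    simpa using this
  have h1 := key _ (isShiftedEigenvalues_nu hρ)
  have h2 := key _ (isShiftedEigenvalues_nuTilde hρ)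
  exact (abs_add_le _ _).trans (by linarith)

/-- The three-term recurrence of the eigenfunctions under the functional, with a bounded
multiplier. -/
theorem spectralFunctional_eigenPoly_rec {ρ : ℝ} (hρ : 0 < ρ) {g : ℝ → ℝ}
    (hg : BoundedOnSpectrum ρ g) (n : ℕ) :
    (n + 1 : ℝ) * spectralFunctional ρ (fun x => x * g x * eigenPoly ρ x n)
      = ρ * spectralFunctional ρ (fun x => g x * eigenPoly ρ x (n + 1))
        - ρ * spectralFunctional ρ (fun x => g x * eigenPoly ρ x n)
        + n * spectralFunctional ρ (fun x => g x * eigenPoly ρ x (n - 1)) := by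
  have hb : ∀ k, BoundedOnSpectrum ρ fun x => g x * eigenPoly ρ x k := fun k =>
    hg.mul (boundedOnSpectrum_eigenPoly ρ k)
  rw [sub_eq_add_neg, ← neg_mul, ← spectralFunctional_const_mul, ← spectralFunctional_const_mul,
    ← spectralFunctional_const_mul, ← spectralFunctional_const_mul,
    ← spectralFunctional_add hρ ((hb _).const_mul _) ((hb _).const_mul _),
    ← spectralFunctional_add hρ _ ((hb _).const_mul _)]
  · refine spectralFunctional_congr hρ fun x _ => ?_
    linear_combination (-g x) * eigenPoly_rec hρ.ne' x n
  · obtain ⟨K, hK, h⟩ := (hb (n + 1)).const_mul ρ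
    obtain ⟨M, hM, h'⟩ := (hb n).const_mul (-ρ)
    exact ⟨K + M, by positivity, fun x hx => (abs_add_le _ _).trans (add_le_add (h x hx) (h' x hx))⟩

/-! ### The initial values of the spectral series -/

theorem half_le_one_sub_mul {ρ u x : ℝ} (h0 : 0 ≤ u) (hu : u * (1 + ρ) ≤ 1 / 2)
    (hx : |x| ≤ 1 + ρ) : 1 / 2 ≤ 1 - u * x := by
  have : u * x ≤ u * (1 + ρ) := mul_le_mul_of_nonneg_left ((le_abs_self x).trans hx) h0
  linarith

theorem abs_resolvent_le {ρ u : ℝ} (h0 : 0 ≤ u) (hu : u * (1 + ρ) ≤ 1 / 2) :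
    ∀ x, |x| ≤ 1 + ρ → |1 / (1 - u * x)| ≤ 2 := by
  intro x hx
  have := half_le_one_sub_mul h0 hu hx
  rw [abs_of_nonneg (one_div_nonneg.2 (by linarith)), div_le_iff₀ (by linarith)]
  linarith

/-- For `n = 0` the resolvent integral is the partial fraction expansion over the spectrum: the two
eigenvalues with index `m + 1` contribute `borelWeight m * (m + 1) / (m + 1 + ρ * (u - u ^ 2))`. -/
theorem spectralFunctional_resolvent_zero {ρ u : ℝ} (hρ : 0 < ρ) (h0 : 0 ≤ u)
    (hu : u * (1 + ρ) ≤ 1 / 2) :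
    spectralFunctional ρ (fun x => 1 / (1 - u * x)) = resolventIntegral ρ 0 u := by
  have hu1 : u ≤ 1 := by nlinarith
  have ha : 0 ≤ ρ * (u - u ^ 2) := mul_nonneg hρ.le (by nlinarith)
  have hb : BoundedOnSpectrum ρ fun x => 1 / (1 - u * x) :=
    ⟨2, by norm_num, abs_resolvent_le h0 hu⟩
  have h := hasSum_borelWeight_div ha
  rw [spectralFunctional,
    ← (summable_spectralWeight_mul hρ (isShiftedEigenvalues_nu hρ) hb).tsum_add
    (summable_spectralWeight_mul hρ (isShiftedEigenvalues_nuTilde hρ) hb)]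
  simp only [resolventIntegral, pow_zero, one_mul]
  rw [← h.tsum_eq]
  refine tsum_congr fun m => ?_
  have hx := abs_le_of_root hρ (nu_root hρ m)
  have hy := abs_le_of_root hρ (nuTilde_root hρ m)
  have hx1 := le_one_of_root hρ (nu_root hρ m)
  have hy1 := le_one_of_root hρ (nuTilde_root hρ m)
  have hs := nu_add_nuTilde ρ m
  have hp := nu_mul_nuTilde hρ m
  unfold spectralWeight
  generalize nu ρ (m + 1) + 1 = x at *
  generalize nuTilde ρ (m + 1) + 1 = y at *
  have d1 : 1 - u * x ≠ 0 := by linarith [half_le_one_sub_mul h0 hu hx]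
  have d2 : 1 - u * y ≠ 0 := by linarith [half_le_one_sub_mul h0 hu hy]
  have d3 : x - 2 ≠ 0 := by linarith
  have d4 : y - 2 ≠ 0 := by linarith
  have d5 : (m : ℝ) + 1 + ρ * (u - u ^ 2) ≠ 0 := by positivity
  have hm : (m : ℝ) + 1 ≠ 0 := by positivity
  -- `(m + 1) * (1 - u * x) * (1 - u * y) = m + 1 + ρ * (u - u ^ 2)`, as `x` and `y` are the roots of the quadratic.
  have e1 : ((m : ℝ) + 1) / ((m : ℝ) + 1 + ρ * (u - u ^ 2)) = 1 / ((1 - u * x) * (1 - u * y)) := by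
    have : (1 - u * x) * (1 - u * y) = 1 + (u ^ 2 - u) * (-ρ / ((m : ℝ) + 1)) := by
      linear_combination u ^ 2 * hp - u * hs
    rw [div_eq_div_iff d5 (mul_ne_zero d1 d2), this]
    field_simp
    ring
  rw [e1, mul_assoc, mul_assoc, ← mul_add]
  congr 1
  rw [← hs] at hp
  rw [div_mul_div_comm, div_mul_div_comm, div_add_div _ _ (mul_ne_zero d3 d1) (mul_ne_zero d4 d2),
    div_eq_div_iff (mul_ne_zero (mul_ne_zero d3 d1) (mul_ne_zero d4 d2)) (mul_ne_zero d1 d2)]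
  linear_combination ((1 - u * x) * (1 - u * y) * (1 - u * (x + y - 2))) * hp

/-- The initial values `∑ C_m(ν) φ_m(n, ν) = 1 / (n + 1)`. The functions `n ↦ ∑ C_m(ν) φ_m(n, ν) /
(1 - u * (ν + 1))` and `resolventIntegral ρ n u` agree for `n = 0`, and satisfy the same recurrence
up to an error that does not depend on `u`. As both are bounded when `u → 0`, the error vanishes,
and they agree for the next `n`. -/
theorem spectralFunctional_eigenPoly {ρ : ℝ} (hρ : 0 < ρ) (n : ℕ) :
    spectralFunctional ρ (fun x => eigenPoly ρ x n) = 1 / ((n : ℝ) + 1) := by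
  set W : ℕ → ℝ → ℝ := fun n u =>
    spectralFunctional ρ (fun x => 1 / (1 - u * x) * eigenPoly ρ x n) with hW
  set u₀ : ℝ := 1 / (2 * (1 + ρ)) with hu₀
  have hu₀pos : 0 < u₀ := by positivity
  have hu₀le : ∀ u ∈ Ioc 0 u₀, u * (1 + ρ) ≤ 1 / 2 := by
    intro u hu
    calc u * (1 + ρ) ≤ u₀ * (1 + ρ) := by gcongr; exact hu.2
      _ = 1 / 2 := by rw [hu₀]; field_simp
  have hWrec : ∀ n : ℕ, ∀ u ∈ Ioc 0 u₀,
      (n + 1 : ℝ) * W n u - u * (ρ * W (n + 1) u - ρ * W n u + n * W (n - 1) u)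
        = (n + 1 : ℝ) * spectralFunctional ρ (fun x => eigenPoly ρ x n) := by
    intro n u hu
    have hb : BoundedOnSpectrum ρ fun x => 1 / (1 - u * x) :=
      ⟨2, by norm_num, abs_resolvent_le hu.1.le (hu₀le u hu)⟩
    have h1 := spectralFunctional_eigenPoly_rec hρ hb n
    have hb1 := hb.mul (boundedOnSpectrum_eigenPoly ρ n)
    have hb2 : BoundedOnSpectrum ρ fun x => x * (1 / (1 - u * x)) * eigenPoly ρ x n :=
      ((boundedOnSpectrum_of_continuous (ρ := ρ) continuous_id).mul hb).mul
        (boundedOnSpectrum_eigenPoly ρ n)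
    have h2 : spectralFunctional ρ (fun x => eigenPoly ρ x n)
        = W n u + (-u) *
          spectralFunctional ρ (fun x => x * (1 / (1 - u * x)) * eigenPoly ρ x n) := by
      rw [hW, ← spectralFunctional_const_mul]
      simp only
      rw [← spectralFunctional_add hρ hb1 (hb2.const_mul (-u))]
      refine spectralFunctional_congr hρ fun x hx => ?_
      have := half_le_one_sub_mul hu.1.le (hu₀le u hu) hx
      have : 1 - u * x ≠ 0 := by linarith
      field_simp
      ring
    rw [h2]
    linear_combination u * h1
  have hWb : ∀ n, ∃ K, ∀ u ∈ Ioc 0 u₀, |W n u| ≤ K := by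
    intro n
    obtain ⟨K, hK, h⟩ := boundedOnSpectrum_eigenPoly ρ n
    refine ⟨2 * (2 * K), fun u hu => abs_spectralFunctional_le hρ fun x hx => ?_⟩
    rw [abs_mul]
    exact mul_le_mul (abs_resolvent_le hu.1.le (hu₀le u hu) x hx) (h x hx)
      (abs_nonneg _) zero_le_two
  have hu1 : ∀ u ∈ Ioc 0 u₀, u ≤ 1 := fun u hu => by nlinarith [hu₀le u hu, hu.1]
  have step : ∀ n : ℕ, (∀ u ∈ Ioc 0 u₀, W n u = resolventIntegral ρ n u) →
      (∀ u ∈ Ioc 0 u₀, (n : ℝ) * W (n - 1) u = n * resolventIntegral ρ (n - 1) u) →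
      (n + 1 : ℝ) * spectralFunctional ρ (fun x => eigenPoly ρ x n) - 1 = 0 ∧
        ∀ u ∈ Ioc 0 u₀, W (n + 1) u = resolventIntegral ρ (n + 1) u := by
    intro n ih ih'
    -- `d` does not depend on `u`, and is `O(u)`.
    set d := (n + 1 : ℝ) * spectralFunctional ρ (fun x => eigenPoly ρ x n) - 1 with hd
    have hdu : ∀ u ∈ Ioc 0 u₀, d = u * (ρ * (resolventIntegral ρ (n + 1) u - W (n + 1) u)) := by
      intro u hu
      have e1 := hWrec n u hu
      have e2 := resolventIntegral_rec hρ.le n hu.1.le (hu1 u hu)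
      have e3 := ih u hu
      have e4 := ih' u hu
      rw [hd, ← e1, e3]
      linear_combination e2 - u * e4
    obtain ⟨K, hK⟩ := hWb (n + 1)
    have hle : ∀ u ∈ Ioc 0 u₀, |d| ≤ u * (ρ * (1 + K)) := by
      intro u hu
      rw [hdu u hu, abs_mul, abs_mul, abs_of_pos hu.1, abs_of_pos hρ]
      have := abs_resolventIntegral_le hρ.le (n + 1) hu.1.le (hu1 u hu)
      have := hK u hu
      gcongr
      · exact hu.1.le
      · exact (abs_sub _ _).trans (by linarith)
    have hd0 : d = 0 := by
      have ht : Filter.Tendsto (fun u : ℝ => u * (ρ * (1 + K))) (nhdsWithin 0 (Ioi 0))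
          (nhds 0) := by
        have : Continuous fun u : ℝ => u * (ρ * (1 + K)) := by fun_prop
        simpa using (this.tendsto 0).mono_left nhdsWithin_le_nhds
      have := ge_of_tendsto ht (Filter.mem_of_superset (Ioc_mem_nhdsGT hu₀pos) hle)
      exact abs_nonpos_iff.1 this
    refine ⟨hd0, fun u hu => ?_⟩
    have h := hdu u hu
    rw [hd0] at h
    have := (mul_eq_zero.1 ((mul_eq_zero.1 h.symm).resolve_left hu.1.ne')).resolve_left hρ.ne'
    linarith
  have hall : ∀ n, ∀ u ∈ Ioc 0 u₀, W n u = resolventIntegral ρ n u := by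
    intro n
    induction n using Nat.strong_induction_on with
    | _ n ih =>
      rcases n with _ | n
      · intro u hu
        rw [← spectralFunctional_resolvent_zero hρ hu.1.le (hu₀le u hu)]
        simp [hW, eigenPoly]
      · refine (step n (ih n (by lia)) fun u hu => ?_).2
        rcases n with _ | n
        · simp
        · rw [ih _ (by lia) u hu]
  have h := (step n (hall n) fun u hu => by rw [hall _ u hu]).1
  have : (n : ℝ) + 1 ≠ 0 := by positivity
  field_simp
  linarith

/-! ### The transition operator of the embedded chain -/

/-- The transition operator of the chain `state`, acting on functions of the number of others and
killed when the tagged customer leaves: `stepOp ρ b f n` is the mean of `f` after one event. -/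
noncomputable def stepOp (ρ : ℝ) (b : ℕ → ℝ) (f : ℕ → ℝ) (n : ℕ) : ℝ :=
  ρ / (1 + ρ) * (b n * f (n + 1) + (1 - b n) * f n)
    + 1 / (1 + ρ) * ((n : ℝ) / ((n : ℝ) + 1) * f (n - 1))

theorem abs_stepOp_le {ρ : ℝ} (hρ : 0 < ρ) {b : ℕ → ℝ} (hb0 : ∀ n, 0 ≤ b n) (hb1 : ∀ n, b n ≤ 1)
    {f : ℕ → ℝ} {C : ℝ} (hf : ∀ n, |f n| ≤ C) (n : ℕ) : |stepOp ρ b f n| ≤ C := by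
  have hC : 0 ≤ C := (abs_nonneg _).trans (hf 0)
  have h1 : |b n * f (n + 1) + (1 - b n) * f n| ≤ C := by
    refine (abs_add_le _ _).trans ?_
    rw [abs_mul, abs_mul, abs_of_nonneg (hb0 n), abs_of_nonneg (sub_nonneg.2 (hb1 n))]
    have := mul_le_mul_of_nonneg_left (hf (n + 1)) (hb0 n)
    have := mul_le_mul_of_nonneg_left (hf n) (sub_nonneg.2 (hb1 n))
    linarith
  have h2 : |(n : ℝ) / ((n : ℝ) + 1) * f (n - 1)| ≤ C := by
    rw [abs_mul, abs_of_nonneg (by positivity)]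
    have : (n : ℝ) / ((n : ℝ) + 1) ≤ 1 := by rw [div_le_one (by positivity)]; linarith
    calc _ ≤ 1 * C := mul_le_mul this (hf _) (abs_nonneg _) zero_le_one
      _ = C := one_mul C
  calc |stepOp ρ b f n| ≤ ρ / (1 + ρ) * C + 1 / (1 + ρ) * C := by
        refine (abs_add_le _ _).trans ?_
        rw [abs_mul (ρ / (1 + ρ)), abs_mul (1 / (1 + ρ)), abs_of_nonneg (by positivity),
          abs_of_nonneg (by positivity : (0 : ℝ) ≤ 1 / (1 + ρ))]
        gcongr
    _ = C := by field_simp; ring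

theorem abs_iterate_stepOp_le {ρ : ℝ} (hρ : 0 < ρ) {b : ℕ → ℝ} (hb0 : ∀ n, 0 ≤ b n)
    (hb1 : ∀ n, b n ≤ 1) {f : ℕ → ℝ} {C : ℝ} (hf : ∀ n, |f n| ≤ C) (k n : ℕ) :
    |(stepOp ρ b)^[k] f n| ≤ C := by
  induction k generalizing n with
  | zero => exact hf n
  | succ k ih =>
    rw [Function.iterate_succ_apply']
    exact abs_stepOp_le hρ hb0 hb1 ih n

theorem joinProb_nonneg (n : ℕ) : 0 ≤ joinProb n := by unfold joinProb; positivity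

theorem joinProb_le_one (n : ℕ) : joinProb n ≤ 1 := by
  unfold joinProb
  rw [div_le_one (by positivity)]
  have : (0 : ℝ) ≤ n := n.cast_nonneg
  linarith

/-- One event decreases the survival probability by `h / (1 + ρ)`, `h n = 1 / (n + 1)`. -/
theorem iterate_stepOp_one_succ {ρ : ℝ} (hρ : 0 < ρ) (b : ℕ → ℝ) (k n : ℕ) :
    (stepOp ρ b)^[k + 1] (fun _ => 1) n
      = (stepOp ρ b)^[k] (fun _ => 1) n
        - 1 / (1 + ρ) * (stepOp ρ b)^[k] (fun j => 1 / ((j : ℝ) + 1)) n := by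
  induction k generalizing n with
  | zero =>
    simp only [zero_add, Function.iterate_one, Function.iterate_zero, id, stepOp]
    field_simp
    ring
  | succ k ih =>
    have hlin : ∀ (f g : ℕ → ℝ) (c : ℝ), stepOp ρ b (fun j => f j - c * g j) n
        = stepOp ρ b f n - c * stepOp ρ b g n := by
      intro f g c
      simp only [stepOp]
      ring
    rw [Function.iterate_succ_apply', funext ih, hlin,
      ← Function.iterate_succ_apply' (stepOp ρ b), ← Function.iterate_succ_apply' (stepOp ρ b)]
    exact congrArg (· - _) (ih n)

/-- With `x = ν + 1`, the transition operator multiplies the eigenfunction by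
`(x + ρ) / (1 + ρ)`. -/
theorem iterate_stepOp_eq_spectralFunctional {ρ : ℝ} (hρ : 0 < ρ) (k n : ℕ) :
    (stepOp ρ joinProb)^[k] (fun j => 1 / ((j : ℝ) + 1)) n
      = spectralFunctional ρ (fun x => ((x + ρ) / (1 + ρ)) ^ k * eigenPoly ρ x n) := by
  induction k generalizing n with
  | zero => simpa using (spectralFunctional_eigenPoly hρ n).symm
  | succ k ih =>
    have hg : BoundedOnSpectrum ρ fun x => ((x + ρ) / (1 + ρ)) ^ k :=
      boundedOnSpectrum_of_continuous (by fun_prop)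
    have h := spectralFunctional_eigenPoly_rec hρ hg n
    have hb1 : BoundedOnSpectrum ρ fun x => x * ((x + ρ) / (1 + ρ)) ^ k * eigenPoly ρ x n :=
      ((boundedOnSpectrum_of_continuous continuous_id).mul hg).mul (boundedOnSpectrum_eigenPoly ρ n)
    have hb2 := hg.mul (boundedOnSpectrum_eigenPoly ρ n)
    have hs : spectralFunctional ρ (fun x => ((x + ρ) / (1 + ρ)) ^ (k + 1) * eigenPoly ρ x n)
        = 1 / (1 + ρ) *
            spectralFunctional ρ (fun x => x * ((x + ρ) / (1 + ρ)) ^ k * eigenPoly ρ x n)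
          + ρ / (1 + ρ) *
            spectralFunctional ρ (fun x => ((x + ρ) / (1 + ρ)) ^ k * eigenPoly ρ x n) := by
      rw [← spectralFunctional_const_mul, ← spectralFunctional_const_mul,
        ← spectralFunctional_add hρ (hb1.const_mul _) (hb2.const_mul _)]
      refine spectralFunctional_congr hρ fun x _ => ?_
      rw [pow_succ]
      ring
    have hn : (n : ℝ) + 1 ≠ 0 := by positivity
    rw [Function.iterate_succ_apply', funext ih, hs]
    have h' := (eq_div_iff hn).2 ((mul_comm _ _).trans h)
    rw [h']
    simp only [stepOp, joinProb]
    field_simp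
    ring

/-! ### Exponential series -/

theorem hasSum_tsum_mul_exp {a y : ℕ → ℝ} {B : ℝ} (ha : Summable a) (hB : 0 ≤ B)
    (hy : ∀ m, |y m| ≤ B) (s : ℝ) :
    HasSum (fun k : ℕ => (∑' m, a m * y m ^ k) * (s ^ k / k !))
      (∑' m, a m * Real.exp (y m * s)) := by
  have hexp : ∀ y : ℝ, HasSum (fun j : ℕ => y ^ j / j !) (Real.exp y) := fun y => by
    rw [Real.exp_eq_exp_ℝ]
    exact NormedSpace.expSeries_div_hasSum_exp y
  set F : ℕ × ℕ → ℝ := fun p => a p.1 * y p.1 ^ p.2 * (s ^ p.2 / p.2 !) with hF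
  have hFs : Summable F := by
    have h1 := ha.norm.mul_of_nonneg (hexp (B * |s|)).summable (fun _ => norm_nonneg _)
      (fun k => by positivity)
    refine Summable.of_norm_bounded h1 fun p => ?_
    simp only [hF, norm_mul, norm_div, norm_pow, mul_pow, Real.norm_eq_abs]
    rw [abs_of_nonneg (by positivity : (0 : ℝ) ≤ (p.2 ! : ℝ)), mul_assoc, mul_div_assoc]
    gcongr
    exact hy _
  have hrow : ∀ m, HasSum (fun k => F (m, k)) (a m * Real.exp (y m * s)) := by
    intro m
    refine ((hexp (y m * s)).mul_left (a m)).congr_fun fun k => ?_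
    simp only [hF, mul_pow]
    ring
  have h1 := hFs.hasSum.prod_fiberwise hrow
  have hswap : HasSum (fun p : ℕ × ℕ => F p.swap) (∑' p, F p) :=
    (Equiv.prodComm ℕ ℕ).hasSum_iff.2 hFs.hasSum
  have h2 := hswap.prod_fiberwise fun k => (hswap.summable.prod_factor k).hasSum
  rw [← h1.tsum_eq] at h2
  refine h2.congr_fun fun k => ?_
  rw [← tsum_mul_right]
  rfl

theorem hasSum_spectralFunctional_exp {ρ : ℝ} (hρ : 0 < ρ) {g q : ℝ → ℝ}
    (hg : BoundedOnSpectrum ρ g) (hq : BoundedOnSpectrum ρ q) (s : ℝ) :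
    HasSum (fun k : ℕ => spectralFunctional ρ (fun x => q x ^ k * g x) * (s ^ k / k !))
      (spectralFunctional ρ (fun x => g x * Real.exp (q x * s))) := by
  obtain ⟨B, hB, hq⟩ := hq
  have key : ∀ x : ℕ → ℝ, IsShiftedEigenvalues ρ x →
      HasSum (fun k : ℕ => (∑' m, spectralWeight m (x m) * (q (x m) ^ k * g (x m))) * (s ^ k / k !))
        (∑' m, spectralWeight m (x m) * (g (x m) * Real.exp (q (x m) * s))) := by
    intro x hx
    have := hasSum_tsum_mul_exp (summable_spectralWeight_mul hρ hx hg) hB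
      (fun m => hq _ (abs_le_of_root hρ (hx.root m))) s
    simp only [mul_assoc] at this
    simpa only [mul_comm (g _)] using this
  have := (key _ (isShiftedEigenvalues_nu hρ)).add (key _ (isShiftedEigenvalues_nuTilde hρ))
  refine this.congr_fun fun k => ?_
  rw [spectralFunctional, add_mul]

theorem summable_mul_pow_div_factorial {v : ℕ → ℝ} {C : ℝ} (hv : ∀ k, |v k| ≤ C) (x : ℝ) :
    Summable fun k : ℕ => v k * (x ^ k / k !) := by
  refine Summable.of_norm_bounded ((Real.summable_pow_div_factorial |x|).mul_left C) fun k => ?_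
  rw [norm_mul, norm_div, norm_pow, Real.norm_of_nonneg (by positivity : (0 : ℝ) ≤ (k ! : ℝ))]
  have := hv k
  simp only [Real.norm_eq_abs]
  gcongr

theorem hasDerivAt_tsum_mul_pow_div_factorial {v : ℕ → ℝ} {C : ℝ} (hv : ∀ k, |v k| ≤ C) (x : ℝ) :
    HasDerivAt (fun x : ℝ => ∑' k : ℕ, v k * (x ^ k / k !)) (∑' k : ℕ, v (k + 1) * (x ^ k / k !))
      x := by
  have hC : 0 ≤ C := (abs_nonneg _).trans (hv 0)
  set R := |x| + 1 with hR
  have hR0 : 0 ≤ R := by positivity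
  set g' : ℕ → ℝ → ℝ := fun k x => v k * ((k : ℝ) * x ^ (k - 1) / k !) with hg'
  have hg'succ : ∀ k y, g' (k + 1) y = v (k + 1) * (y ^ k / k !) := by
    intro k y
    simp only [hg', Nat.factorial_succ, Nat.add_sub_cancel]
    push_cast
    field_simp
  have h := hasDerivAt_tsum_of_isPreconnected (𝕜 := ℝ)
    (g := fun (k : ℕ) (x : ℝ) => v k * (x ^ k / k !)) (g' := g')
    (u := fun k : ℕ => C * ((k : ℝ) * R ^ (k - 1) / k !)) (t := Metric.ball 0 R) (y₀ := 0) (y := x)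
    (by
      rw [← summable_nat_add_iff 1]
      refine ((Real.summable_pow_div_factorial R).mul_left C).congr fun k => ?_
      simp only [Nat.factorial_succ, Nat.add_sub_cancel]
      push_cast
      field_simp)
    Metric.isOpen_ball (convex_ball 0 R).isPreconnected
    (fun k y _ => ((hasDerivAt_pow k y).div_const _).const_mul _)
    (fun k y hy => by
      have hyR : |y| ≤ R := by simpa using (Metric.mem_ball.1 hy).le
      simp only [hg', norm_mul, norm_div, norm_pow, Real.norm_eq_abs, Nat.abs_cast]
      have := hv k
      gcongr)
    (by simp [hR]; positivity) (summable_mul_pow_div_factorial hv 0) (by simp [hR])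
  refine h.congr_deriv ?_
  have hs : Summable fun k => g' k x := by
    rw [← summable_nat_add_iff 1]
    simp only [hg'succ]
    exact summable_mul_pow_div_factorial (fun k => hv (k + 1)) x
  rw [hs.tsum_eq_zero_add]
  simp only [hg'succ]
  simp [hg']

/-- The derivative of a mixture of Poisson probabilities. -/
theorem hasDerivAt_tsum_poisson {v : ℕ → ℝ} {C : ℝ} (hv : ∀ k, |v k| ≤ C) (r t : ℝ) :
    HasDerivAt (fun t : ℝ => Real.exp (-(r * t)) * ∑' k : ℕ, v k * ((r * t) ^ k / k !))
      (r * (Real.exp (-(r * t)) * ∑' k : ℕ, (v (k + 1) - v k) * ((r * t) ^ k / k !))) t := by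
  have h1 : HasDerivAt (fun t : ℝ => r * t) r t := by simpa using (hasDerivAt_id t).const_mul r
  have h2 := (hasDerivAt_tsum_mul_pow_div_factorial hv (r * t)).comp t h1
  refine ((h1.neg.exp).mul h2).congr_deriv ?_
  simp only [sub_mul, Function.comp]
  rw [(summable_mul_pow_div_factorial (fun k => hv (k + 1)) _).tsum_sub
    (summable_mul_pow_div_factorial hv _)]
  simp
  ring

/-- The mixture of Poisson probabilities whose coefficients are the survival probabilities of the
embedded chain has the spectral series as its density. -/
theorem hasDerivAt_tsum_survival {ρ : ℝ} (hρ : 0 < ρ) (n : ℕ) (t : ℝ) :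
    HasDerivAt (fun t : ℝ => Real.exp (-((1 + ρ) * t)) *
        ∑' k : ℕ, (stepOp ρ joinProb)^[k] (fun _ => 1) n * (((1 + ρ) * t) ^ k / k !))
      (-spectralFunctional ρ (fun x => eigenPoly ρ x n * Real.exp ((x - 1) * t))) t := by
  have hv : ∀ k, |(stepOp ρ joinProb)^[k] (fun _ => 1) n| ≤ 1 := fun k =>
    abs_iterate_stepOp_le hρ joinProb_nonneg joinProb_le_one (by simp) k n
  refine (hasDerivAt_tsum_poisson hv (1 + ρ) t).congr_deriv ?_
  have hs := hasSum_spectralFunctional_exp hρ (boundedOnSpectrum_eigenPoly ρ n)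
    (boundedOnSpectrum_of_continuous (g := fun x => (x + ρ) / (1 + ρ)) (by fun_prop)) ((1 + ρ) * t)
  have e1 : ∀ k : ℕ, ((stepOp ρ joinProb)^[k + 1] (fun _ => 1) n
      - (stepOp ρ joinProb)^[k] (fun _ => 1) n) * (((1 + ρ) * t) ^ k / k !)
      = (-(1 / (1 + ρ))) * (spectralFunctional ρ
        (fun x => ((x + ρ) / (1 + ρ)) ^ k * eigenPoly ρ x n) * (((1 + ρ) * t) ^ k / k !)) := by
    intro k
    rw [iterate_stepOp_one_succ hρ, iterate_stepOp_eq_spectralFunctional hρ]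
    ring
  simp only [e1]
  rw [tsum_mul_left, hs.tsum_eq]
  have e2 : spectralFunctional ρ (fun x => eigenPoly ρ x n * Real.exp ((x - 1) * t))
      = Real.exp (-((1 + ρ) * t)) * spectralFunctional ρ
        (fun x => eigenPoly ρ x n * Real.exp ((x + ρ) / (1 + ρ) * ((1 + ρ) * t))) := by
    rw [← spectralFunctional_const_mul]
    refine spectralFunctional_congr hρ fun x _ => ?_
    have : (x + ρ) / (1 + ρ) * ((1 + ρ) * t) = (x + ρ) * t := by field_simp
    rw [this, mul_left_comm, ← Real.exp_add]
    ring_nf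
  rw [e2]
  field_simp

theorem spectralTerm_eq {ρ : ℝ} (hρ : 0 < ρ) {m : ℕ} {ν : ℝ}
    (hν : ((m : ℝ) + 1) * (ν + 1) ^ 2 = ρ * (1 - (ν + 1))) (n : ℕ) (t : ℝ) :
    spectralTerm ρ n t (m + 1) ν
      = spectralWeight m (ν + 1) * (eigenPoly ρ (ν + 1) n * Real.exp ((ν + 1 - 1) * t)) := by
  rw [spectralTerm, coeff_eq_spectralWeight, phi_eq_eigenPoly hρ hν, mul_assoc,
    add_sub_cancel_right]

/-- A tail that is this mixture of Poisson probabilities is differentiable on `[0, ∞)`, with the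
absolutely convergent spectral series as its density. -/
theorem density_of_tail {ρ : ℝ} (hρ : 0 < ρ) {n : ℕ} {V : ℝ → ℝ}
    (hV : ∀ t, 0 ≤ t → V t = Real.exp (-((1 + ρ) * t)) *
      ∑' k : ℕ, (stepOp ρ joinProb)^[k] (fun _ => 1) n * (((1 + ρ) * t) ^ k / k !))
    {t : ℝ} (ht : 0 ≤ t) :
    DifferentiableWithinAt ℝ V (Ici 0) t ∧
    Summable (fun m : ℕ => spectralTerm ρ n t (m + 1) (nu ρ (m + 1))) ∧
    Summable (fun m : ℕ => spectralTerm ρ n t (m + 1) (nuTilde ρ (m + 1))) ∧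
    -derivWithin V (Ici 0) t =
      (∑' m : ℕ, spectralTerm ρ n t (m + 1) (nu ρ (m + 1))) +
      ∑' m : ℕ, spectralTerm ρ n t (m + 1) (nuTilde ρ (m + 1)) := by
  have hd : HasDerivWithinAt V
      (-spectralFunctional ρ (fun x => eigenPoly ρ x n * Real.exp ((x - 1) * t))) (Ici 0) t :=
    (hasDerivAt_tsum_survival hρ n t).hasDerivWithinAt.congr (fun s hs => hV s hs) (hV t ht)
  set g : ℝ → ℝ := fun x => eigenPoly ρ x n * Real.exp ((x - 1) * t) with hg
  have hb : BoundedOnSpectrum ρ g :=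
    (boundedOnSpectrum_eigenPoly ρ n).mul
      (boundedOnSpectrum_of_continuous (g := fun x => Real.exp ((x - 1) * t)) (by fun_prop))
  have e1 : (fun m : ℕ => spectralTerm ρ n t (m + 1) (nu ρ (m + 1)))
      = fun m => spectralWeight m (nu ρ (m + 1) + 1) * g (nu ρ (m + 1) + 1) :=
    funext fun m => spectralTerm_eq hρ (nu_root hρ m) n t
  have e2 : (fun m : ℕ => spectralTerm ρ n t (m + 1) (nuTilde ρ (m + 1)))
      = fun m => spectralWeight m (nuTilde ρ (m + 1) + 1) * g (nuTilde ρ (m + 1) + 1) :=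
    funext fun m => spectralTerm_eq hρ (nuTilde_root hρ m) n t
  rw [e1, e2]
  refine ⟨hd.differentiableWithinAt,
    summable_spectralWeight_mul hρ (isShiftedEigenvalues_nu hρ) hb,
    summable_spectralWeight_mul hρ (isShiftedEigenvalues_nuTilde hρ) hb, ?_⟩
  rw [hd.derivWithin (uniqueDiffOn_Ici 0 t ht), neg_neg, spectralFunctional]

/-! ### The law of one event -/

theorem measurable_exponentialPDF (r : ℝ) : Measurable (exponentialPDF r) :=
  (measurable_exponentialPDFReal r).ennreal_ofReal

theorem lintegral_expMeasure (r : ℝ) {g : ℝ → ℝ≥0∞} (hg : Measurable g) :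
    ∫⁻ x, g x ∂expMeasure r = ∫⁻ x, exponentialPDF r x * g x :=
  lintegral_withDensity_eq_lintegral_mul volume (measurable_exponentialPDF r) hg

theorem expMeasure_Ioi {r : ℝ} (hr : 0 < r) {x : ℝ} (hx : 0 ≤ x) :
    expMeasure r (Ioi x) = ENNReal.ofReal (Real.exp (-(r * x))) := by
  have := isProbabilityMeasure_expMeasure hr
  rw [← compl_Iic, prob_compl_eq_one_sub measurableSet_Iic, ← ofReal_cdf, cdf_expMeasure_eq hr,
    if_pos hx, ← ENNReal.ofReal_one, ← ENNReal.ofReal_sub]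
  · ring_nf
  · have : Real.exp (-(r * x)) ≤ 1 := Real.exp_le_one_iff.2 (by nlinarith)
    linarith

theorem expMeasure_Ici {r : ℝ} (hr : 0 < r) {x : ℝ} (hx : 0 ≤ x) :
    expMeasure r (Ici x) = ENNReal.ofReal (Real.exp (-(r * x))) := by
  rw [← expMeasure_Ioi hr hx]
  have h : expMeasure r ≪ volume := withDensity_absolutelyContinuous _ _
  exact measure_congr (h.ae_le Ioi_ae_eq_Ici.symm)

theorem expMeasure_Iio_zero {r : ℝ} (hr : 0 < r) : expMeasure r (Iio 0) = 0 := by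
  have := isProbabilityMeasure_expMeasure hr
  rw [← compl_Ici, prob_compl_eq_one_sub measurableSet_Ici, expMeasure_Ici hr le_rfl]
  simp

/-- Thinning a clock of rate `r` by the survival function of a clock of rate `q`. -/
theorem lintegral_expMeasure_mul_exp {r q : ℝ} (hr : 0 < r) (hq : 0 < q) {h : ℝ → ℝ≥0∞}
    (hh : Measurable h) :
    ∫⁻ x, h x * ENNReal.ofReal (Real.exp (-(q * x))) ∂expMeasure r
      = ENNReal.ofReal (r / (r + q)) * ∫⁻ x, h x ∂expMeasure (r + q) := by
  rw [lintegral_expMeasure _ hh, lintegral_expMeasure _ (by fun_prop),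
    ← lintegral_const_mul _ (by have := measurable_exponentialPDF (r + q); fun_prop)]
  refine lintegral_congr fun x => ?_
  rcases lt_or_ge x 0 with hx | hx
  · simp [exponentialPDF_of_neg hx]
  · rw [exponentialPDF_of_nonneg hx, exponentialPDF_of_nonneg hx, mul_left_comm,
      ← ENNReal.ofReal_mul (by positivity), ← mul_assoc, ← ENNReal.ofReal_mul (by positivity),
      mul_comm (h x)]
    congr 2
    rw [mul_assoc, ← Real.exp_add]
    field_simp
    ring_nf

/-- Integrals over the first of two competing exponential clocks. -/
theorem lintegral_expMeasure_first {r q : ℝ} (hr : 0 < r) (hq : 0 < q) {h : ℝ → ℝ≥0∞}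
    (hh : Measurable h) {A : ℝ → Set ℝ}
    (hA : ∀ x, 0 ≤ x → expMeasure q (A x) = ENNReal.ofReal (Real.exp (-(q * x))))
    (hAm : ∀ x, MeasurableSet (A x)) :
    ∫⁻ x, ∫⁻ y, (A x).indicator (fun _ => h x) y ∂expMeasure q ∂expMeasure r
      = ENNReal.ofReal (r / (r + q)) * ∫⁻ x, h x ∂expMeasure (r + q) := by
  rw [← lintegral_expMeasure_mul_exp hr hq hh]
  refine lintegral_congr_ae ?_
  have h0 : ∀ᵐ x ∂expMeasure r, x ∈ (Iio (0 : ℝ))ᶜ := compl_mem_ae_iff.2 (expMeasure_Iio_zero hr)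
  filter_upwards [h0] with x hx
  rw [lintegral_indicator_const (hAm x), hA x (by simpa using hx)]

theorem lintegral_uniform_ite {c : ℝ} (h0 : 0 ≤ c) (h1 : c ≤ 1) (x y : ℝ≥0∞) :
    ∫⁻ u in Icc (0 : ℝ) 1, (if u < c then x else y)
      = ENNReal.ofReal c * x + ENNReal.ofReal (1 - c) * y := by
  have e : ∀ u : ℝ, (if u < c then x else y)
      = (Iio c).indicator (fun _ => x) u + (Ici c).indicator (fun _ => y) u := by
    intro u
    by_cases hu : u < c
    · simp [hu]
    · simp [hu, not_lt.1 hu]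
  simp only [e]
  rw [lintegral_add_left (measurable_const.indicator measurableSet_Iio),
    lintegral_indicator_const measurableSet_Iio, lintegral_indicator_const measurableSet_Ici,
    Measure.restrict_apply measurableSet_Iio, Measure.restrict_apply measurableSet_Ici]
  have e1 : Iio c ∩ Icc 0 1 = Ico 0 c := by
    ext u
    simp only [mem_inter_iff, mem_Iio, mem_Icc, mem_Ico]
    constructor
    · rintro ⟨a, b, _⟩; exact ⟨b, a⟩
    · rintro ⟨a, b⟩; exact ⟨b, a, by linarith⟩
  have e2 : Ici c ∩ Icc 0 1 = Icc c 1 := by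
    ext u
    simp only [mem_inter_iff, mem_Ici, mem_Icc]
    constructor
    · rintro ⟨a, _, b⟩; exact ⟨a, b⟩
    · rintro ⟨a, b⟩; exact ⟨a, by linarith, b⟩
  rw [e1, e2, Real.volume_Ico, Real.volume_Icc, sub_zero, mul_comm x, mul_comm y]

/-- The length of the period that ends with the event. -/
noncomputable def wait (e : ℝ × ℝ × ℝ) : ℝ := min e.1 e.2.1

theorem measurable_wait : Measurable wait := by unfold wait; fun_prop

/-- All states are distinguished by measurable sets. -/
instance instMeasurableSpaceState : MeasurableSpace (Option ℕ) := ⊤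

instance instDiscreteMeasurableSpaceState : DiscreteMeasurableSpace (Option ℕ) := ⟨fun _ => trivial⟩

theorem measurable_step (b : ℕ → ℝ) (o : Option ℕ) : Measurable (step b o) := by
  rcases o with _ | j
  · exact measurable_const
  · unfold step
    refine Measurable.ite (measurableSet_lt (by fun_prop) (by fun_prop)) ?_ ?_
    · exact Measurable.ite (measurableSet_lt (by fun_prop) (by fun_prop)) measurable_const
        measurable_const
    · exact Measurable.ite (measurableSet_lt (by fun_prop) (by fun_prop)) measurable_const
        measurable_const

theorem measurable_step_uncurry (b : ℕ → ℝ) :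
    Measurable fun p : Option ℕ × (ℝ × ℝ × ℝ) => step b p.1 p.2 :=
  measurable_from_prod_countable_right fun o => measurable_step b o

/-- The integral over one event of a function of the winning clock `a < s` or `s ≤ a`, the length
of the period, and the uniform variable. -/
theorem lintegral_eventLaw {ρ : ℝ} (hρ : 0 < ρ) {h : ℝ → ℝ≥0∞} (hh : Measurable h)
    {c d : ℝ} (hc0 : 0 ≤ c) (hc1 : c ≤ 1) (hd0 : 0 ≤ d) (hd1 : d ≤ 1) (x x' y y' : ℝ≥0∞) :
    ∫⁻ e, (if e.1 < e.2.1 then (if e.2.2 < c then x else x') else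
        (if e.2.2 < d then y else y')) * h (wait e) ∂eventLaw ρ
      = (ENNReal.ofReal (ρ / (1 + ρ)) * (ENNReal.ofReal c * x + ENNReal.ofReal (1 - c) * x')
        + ENNReal.ofReal (1 / (1 + ρ)) * (ENNReal.ofReal d * y + ENNReal.ofReal (1 - d) * y'))
        * ∫⁻ r, h r ∂expMeasure (1 + ρ) := by
  have := isProbabilityMeasure_expMeasure hρ
  have := isProbabilityMeasure_expMeasure one_pos
  set X := ENNReal.ofReal c * x + ENNReal.ofReal (1 - c) * x' with hX
  set Y := ENNReal.ofReal d * y + ENNReal.ofReal (1 - d) * y' with hY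
  have hm : Measurable fun e : ℝ × ℝ × ℝ => (if e.1 < e.2.1 then (if e.2.2 < c then x else x') else
      (if e.2.2 < d then y else y')) * h (wait e) := by
    refine Measurable.mul ?_ (hh.comp measurable_wait)
    refine Measurable.ite (measurableSet_lt (by fun_prop) (by fun_prop)) ?_ ?_
    · exact Measurable.ite (measurableSet_lt (by fun_prop) (by fun_prop)) measurable_const
        measurable_const
    · exact Measurable.ite (measurableSet_lt (by fun_prop) (by fun_prop)) measurable_const
        measurable_const
  have hinner : ∀ a, ∫⁻ p, (if a < p.1 then (if p.2 < c then x else x') else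
      (if p.2 < d then y else y')) * h (wait (a, p))
        ∂(expMeasure 1).prod (volume.restrict (Icc (0 : ℝ) 1))
      = ∫⁻ s, ((Ioi a).indicator (fun _ => X * h a) s + (Iic a).indicator (fun s => Y * h s) s)
        ∂expMeasure 1 := by
    intro a
    have hma : Measurable fun p : ℝ × ℝ => (if a < p.1 then (if p.2 < c then x else x') else
        (if p.2 < d then y else y')) * h (wait (a, p)) :=
      hm.comp (measurable_const.prodMk measurable_id)
    rw [lintegral_prod _ hma.aemeasurable]
    refine lintegral_congr fun s => ?_
    simp only [wait]
    rcases lt_or_ge a s with has | has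
    · simp only [if_pos has]
      rw [lintegral_mul_const _ (Measurable.ite (measurableSet_lt (by fun_prop) (by fun_prop))
        measurable_const measurable_const), lintegral_uniform_ite hc0 hc1]
      simp [has, min_eq_left has.le, hX]
    · simp only [if_neg (not_lt.2 has)]
      rw [lintegral_mul_const _ (Measurable.ite (measurableSet_lt (by fun_prop) (by fun_prop))
        measurable_const measurable_const), lintegral_uniform_ite hd0 hd1]
      simp [has, hY]
  rw [eventLaw, lintegral_prod _ hm.aemeasurable]
  simp only [hinner]
  have hm1 : Measurable fun p : ℝ × ℝ => (Ioi p.1).indicator (fun _ => X * h p.1) p.2 := by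
    have : (fun p : ℝ × ℝ => (Ioi p.1).indicator (fun _ => X * h p.1) p.2)
        = {p : ℝ × ℝ | p.1 < p.2}.indicator fun p => X * h p.1 := by
      ext p; simp [indicator]
    rw [this]
    exact Measurable.indicator (by fun_prop) (measurableSet_lt measurable_fst measurable_snd)
  have hm2 : Measurable fun p : ℝ × ℝ => (Iic p.1).indicator (fun s => Y * h s) p.2 := by
    have : (fun p : ℝ × ℝ => (Iic p.1).indicator (fun s => Y * h s) p.2)
        = {p : ℝ × ℝ | p.2 ≤ p.1}.indicator fun p => Y * h p.2 := by
      ext p; simp [indicator]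
    rw [this]
    exact Measurable.indicator (by fun_prop) (measurableSet_le measurable_snd measurable_fst)
  have hsplit : ∀ a, ∫⁻ s, ((Ioi a).indicator (fun _ => X * h a) s
        + (Iic a).indicator (fun s => Y * h s) s) ∂expMeasure 1
      = ∫⁻ s, (Ioi a).indicator (fun _ => X * h a) s ∂expMeasure 1
        + ∫⁻ s, (Iic a).indicator (fun s => Y * h s) s ∂expMeasure 1 := fun a =>
    lintegral_add_left (hm1.comp (measurable_const.prodMk measurable_id)) _
  simp only [hsplit]
  rw [lintegral_add_left hm1.lintegral_prod_right', lintegral_lintegral_swap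
    (f := fun a s => (Iic a).indicator (fun s => Y * h s) s) hm2.aemeasurable]
  have e1 := lintegral_expMeasure_first hρ one_pos (hh.const_mul X) (A := fun a => Ioi a)
    (fun a ha => expMeasure_Ioi one_pos ha) (fun _ => measurableSet_Ioi)
  have e2 := lintegral_expMeasure_first one_pos hρ (hh.const_mul Y) (A := fun a => Ici a)
    (fun a ha => expMeasure_Ici hρ ha) (fun _ => measurableSet_Ici)
  have e3 : ∀ s a : ℝ, (Iic a).indicator (fun s => Y * h s) s
      = (Ici s).indicator (fun _ => Y * h s) a := by
    intro s a; simp [indicator]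
  simp only [e3]
  rw [e1, e2, lintegral_const_mul _ hh, lintegral_const_mul _ hh, add_comm ρ 1]
  ring

/-- `stepOp` for functions with values in `[0, ∞]`. -/
noncomputable def stepOpENN (ρ : ℝ) (b : ℕ → ℝ) (f : ℕ → ℝ≥0∞) (n : ℕ) : ℝ≥0∞ :=
  ENNReal.ofReal (ρ / (1 + ρ)) *
      (ENNReal.ofReal (b n) * f (n + 1) + ENNReal.ofReal (1 - b n) * f n)
    + ENNReal.ofReal (1 / (1 + ρ)) * (ENNReal.ofReal ((n : ℝ) / ((n : ℝ) + 1)) * f (n - 1))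

/-- The new state and the length of the period are independent. -/
theorem lintegral_step {ρ : ℝ} (hρ : 0 < ρ) {b : ℕ → ℝ} (hb0 : ∀ n, 0 ≤ b n) (hb1 : ∀ n, b n ≤ 1)
    (f : ℕ → ℝ≥0∞) {h : ℝ → ℝ≥0∞} (hh : Measurable h) (o : Option ℕ) :
    ∫⁻ e, (step b o e).elim 0 f * h (wait e) ∂eventLaw ρ
      = o.elim 0 (stepOpENN ρ b f) * ∫⁻ r, h r ∂expMeasure (1 + ρ) := by
  rcases o with _ | j
  · simp [step]
  · have hj : (1 : ℝ) / ((j : ℝ) + 1) ≤ 1 := joinProb_le_one j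
    have h1 := lintegral_eventLaw hρ hh (hb0 j) (hb1 j) (by positivity) hj (f (j + 1)) (f j) 0
      (f (j - 1))
    have e : ∀ e : ℝ × ℝ × ℝ, (step b (some j) e).elim 0 f
        = if e.1 < e.2.1 then (if e.2.2 < b j then f (j + 1) else f j) else
          (if e.2.2 < 1 / ((j : ℝ) + 1) then 0 else f (j - 1)) := by
      rintro ⟨a, s, u⟩
      simp only [step]
      split_ifs <;> rfl
    simp only [e, h1]
    have : 1 - 1 / ((j : ℝ) + 1) = (j : ℝ) / ((j : ℝ) + 1) := by field_simp; ring
    rw [this]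
    simp [stepOpENN]

theorem lintegral_wait {ρ : ℝ} (hρ : 0 < ρ) {h : ℝ → ℝ≥0∞} (hh : Measurable h) :
    ∫⁻ e, h (wait e) ∂eventLaw ρ = ∫⁻ r, h r ∂expMeasure (1 + ρ) := by
  have h1 := lintegral_eventLaw hρ hh zero_le_one le_rfl zero_le_one le_rfl 1 1 1 1
  simp only [ite_self, one_mul, sub_self, ENNReal.ofReal_zero, add_zero, ENNReal.ofReal_one,
    mul_one] at h1
  rw [h1, ← ENNReal.ofReal_add (by positivity) (by positivity), ← add_div, add_comm ρ 1,
    div_self (by positivity), ENNReal.ofReal_one, one_mul]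

theorem ofReal_stepOp {ρ : ℝ} (hρ : 0 < ρ) {b : ℕ → ℝ} (hb0 : ∀ n, 0 ≤ b n) (hb1 : ∀ n, b n ≤ 1)
    {f : ℕ → ℝ} (hf : ∀ n, 0 ≤ f n) (n : ℕ) :
    0 ≤ stepOp ρ b f n ∧
      stepOpENN ρ b (fun j => ENNReal.ofReal (f j)) n = ENNReal.ofReal (stepOp ρ b f n) := by
  have h0 := hb0 n
  have h1 : 0 ≤ 1 - b n := sub_nonneg.2 (hb1 n)
  have := hf n
  have := hf (n + 1)
  have := hf (n - 1)
  refine ⟨by unfold stepOp; positivity, ?_⟩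
  unfold stepOp stepOpENN
  rw [ENNReal.ofReal_add (by positivity) (by positivity), ENNReal.ofReal_mul (by positivity),
    ENNReal.ofReal_add (by positivity) (by positivity), ENNReal.ofReal_mul h0,
    ENNReal.ofReal_mul h1, ENNReal.ofReal_mul (by positivity : 0 ≤ 1 / (1 + ρ)),
    ENNReal.ofReal_mul (by positivity : 0 ≤ (n : ℝ) / ((n : ℝ) + 1))]

theorem ofReal_iterate_stepOp_one {ρ : ℝ} (hρ : 0 < ρ) {b : ℕ → ℝ} (hb0 : ∀ n, 0 ≤ b n)
    (hb1 : ∀ n, b n ≤ 1) (k n : ℕ) :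
    0 ≤ (stepOp ρ b)^[k] (fun _ => 1) n ∧
      (stepOpENN ρ b)^[k] (fun _ => 1) n = ENNReal.ofReal ((stepOp ρ b)^[k] (fun _ => 1) n) := by
  induction k generalizing n with
  | zero => simp
  | succ k ih =>
    rw [Function.iterate_succ_apply', Function.iterate_succ_apply', funext fun j => (ih j).2]
    exact ofReal_stepOp hρ hb0 hb1 (fun j => (ih j).1) n

/-! ### Poisson probabilities -/

/-- The probability that a Poisson process of rate `r` has `k` events up to time `t`, and `0` if
`t < 0`. -/
noncomputable def poissonProb (r : ℝ) (k : ℕ) (t : ℝ) : ℝ≥0∞ :=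
  if 0 ≤ t then ENNReal.ofReal (Real.exp (-(r * t)) * ((r * t) ^ k / k !)) else 0

theorem measurable_poissonProb (r : ℝ) (k : ℕ) : Measurable (poissonProb r k) :=
  Measurable.ite measurableSet_Ici (by fun_prop) measurable_const

theorem lintegral_poissonProb_sub {r : ℝ} (hr : 0 < r) (k : ℕ) (t : ℝ) :
    ∫⁻ x, poissonProb r k (t - x) ∂expMeasure r = poissonProb r (k + 1) t := by
  have hm : Measurable fun x => poissonProb r k (t - x) :=
    (measurable_poissonProb r k).comp (measurable_const.sub measurable_id)
  rw [lintegral_expMeasure _ hm]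
  have e : ∀ x, exponentialPDF r x * poissonProb r k (t - x)
      = (Icc 0 t).indicator (fun x => ENNReal.ofReal
          (r * Real.exp (-(r * t)) * ((r * (t - x)) ^ k / k !))) x := by
    intro x
    by_cases hx : x ∈ Icc 0 t
    · rw [indicator_of_mem hx, exponentialPDF_of_nonneg hx.1, poissonProb,
        if_pos (sub_nonneg.2 hx.2), ← ENNReal.ofReal_mul (by positivity)]
      congr 1
      have : Real.exp (-(r * t)) = Real.exp (-(r * x)) * Real.exp (-(r * (t - x))) := by
        rw [← Real.exp_add]; ring_nf
      rw [this]
      ring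
    · rw [indicator_of_notMem hx]
      rcases lt_or_ge x 0 with h | h
      · rw [exponentialPDF_of_neg h, zero_mul]
      · have : ¬ 0 ≤ t - x := fun h' => hx ⟨h, by linarith⟩
        rw [poissonProb, if_neg this, mul_zero]
  simp only [e]
  rw [lintegral_indicator measurableSet_Icc]
  rcases lt_or_ge t 0 with ht | ht
  · rw [Icc_eq_empty (by linarith), poissonProb, if_neg (by linarith)]
    simp
  · rw [← ofReal_integral_eq_lintegral_ofReal, integral_Icc_eq_integral_Ioc,
      ← intervalIntegral.integral_of_le ht, poissonProb, if_pos ht]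
    · congr 1
      have h := intervalIntegral.integral_eq_sub_of_hasDerivAt (a := (0 : ℝ)) (b := t)
        (f := fun x => -(Real.exp (-(r * t)) * ((r * (t - x)) ^ (k + 1) / (k + 1)!)))
        (f' := fun x => r * Real.exp (-(r * t)) * ((r * (t - x)) ^ k / k !))
        (fun x _ => by
          have h1 : HasDerivAt (fun x : ℝ => r * (t - x)) (-r) x := by
            simpa using ((hasDerivAt_id x).const_sub t).const_mul r
          refine ((((h1.pow (k + 1)).div_const _).const_mul _).neg).congr_deriv ?_
          rw [Nat.factorial_succ]
          push_cast
          field_simp)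
        ((by fun_prop : Continuous fun x =>
          r * Real.exp (-(r * t)) * ((r * (t - x)) ^ k / k !)).intervalIntegrable _ _)
      rw [h]
      simp
    · exact (by fun_prop : Continuous fun x =>
          r * Real.exp (-(r * t)) * ((r * (t - x)) ^ k / k !)).integrableOn_Icc
    · refine (ae_restrict_iff' measurableSet_Icc).2 (Filter.Eventually.of_forall fun x hx => ?_)
      have : 0 ≤ r * (t - x) := mul_nonneg hr.le (sub_nonneg.2 hx.2)
      positivity

/-- The survival function of a clock, in the notation for Poisson probabilities. -/
theorem ite_expMeasure_Ioi {r : ℝ} (hr : 0 < r) (t : ℝ) :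
    (if 0 ≤ t then expMeasure r (Ioi t) else 0) = poissonProb r 0 t := by
  unfold poissonProb
  split_ifs with h
  · rw [expMeasure_Ioi hr h]
    simp
  · rfl

/-! ### The tail of the sojourn time -/

section

variable {Ω : Type*}

/-- The time of the `k`-th event. -/
noncomputable def eventTime (ξ : ℕ → Ω → ℝ × ℝ × ℝ) (k : ℕ) (ω : Ω) : ℝ :=
  ∑ i ∈ Finset.range k, wait (ξ i ω)

theorem eventTime_succ (ξ : ℕ → Ω → ℝ × ℝ × ℝ) (k : ℕ) (ω : Ω) :
    eventTime ξ (k + 1) ω = eventTime ξ k ω + wait (ξ k ω) := Finset.sum_range_succ _ _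

theorem measurable_state [MeasurableSpace Ω] (b : ℕ → ℝ) {ξ : ℕ → Ω → ℝ × ℝ × ℝ} (n k : ℕ)
    (hξ : ∀ i < k, Measurable (ξ i)) : Measurable (state b ξ n k) := by
  induction k with
  | zero => exact measurable_const
  | succ k ih =>
    exact (measurable_step_uncurry b).comp
      ((ih fun i hi => hξ i (by lia)).prodMk (hξ k (by lia)))

theorem measurable_eventTime [MeasurableSpace Ω] {ξ : ℕ → Ω → ℝ × ℝ × ℝ} (k : ℕ)
    (hξ : ∀ i < k, Measurable (ξ i)) : Measurable (eventTime ξ k) :=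
  Finset.measurable_fun_sum _ fun i hi => measurable_wait.comp (hξ i (Finset.mem_range.1 hi))

theorem measurable_state_eventTime [MeasurableSpace Ω] (b : ℕ → ℝ) {ξ : ℕ → Ω → ℝ × ℝ × ℝ}
    (n k : ℕ) (hξ : ∀ i < k, Measurable (ξ i)) :
    Measurable fun ω => (state b ξ n k ω, eventTime ξ k ω) :=
  (measurable_state b n k hξ).prodMk (measurable_eventTime k hξ)

theorem isSome_state_of_le (b : ℕ → ℝ) (ξ : ℕ → Ω → ℝ × ℝ × ℝ) (n : ℕ) (ω : Ω) {i k : ℕ}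
    (hik : i ≤ k) (h : (state b ξ n k ω).isSome) : (state b ξ n i ω).isSome := by
  induction k, hik using Nat.le_induction with
  | base => exact h
  | succ k _ ih =>
    refine ih ?_
    by_contra hn
    have hnone : state b ξ n k ω = none := by simpa using hn
    rw [state, hnone] at h
    simp [step] at h

/-- The sojourn time exceeds `t` if and only if the tagged customer is present during the period
that contains `t`. -/
theorem lt_sojournTime_iff (b : ℕ → ℝ) {ξ : ℕ → Ω → ℝ × ℝ × ℝ} (n : ℕ) {ω : Ω}
    (hw : ∀ k, 0 ≤ wait (ξ k ω)) {t : ℝ} (ht : 0 ≤ t) :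
    ENNReal.ofReal t < sojournTime b ξ n ω ↔
      ∃ k, (state b ξ n k ω).isSome ∧ eventTime ξ k ω ≤ t ∧ t < eventTime ξ (k + 1) ω := by
  set a : ℕ → ℝ≥0∞ := fun k => if (state b ξ n k ω).isSome then
    ENNReal.ofReal (min (ξ k ω).1 (ξ k ω).2.1) else 0 with ha
  have hS : sojournTime b ξ n ω = ∑' k, a k := rfl
  have hsum : ∀ k, (state b ξ n k ω).isSome →
      ∑ i ∈ Finset.range (k + 1), a i = ENNReal.ofReal (eventTime ξ (k + 1) ω) := by
    intro k hk
    rw [eventTime, ENNReal.ofReal_sum_of_nonneg fun i _ => hw i]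
    refine Finset.sum_congr rfl fun i hi => ?_
    have hik := isSome_state_of_le b ξ n ω (Nat.lt_succ_iff.1 (Finset.mem_range.1 hi)) hk
    simp [ha, hik, wait]
  rw [hS]
  constructor
  · intro h
    rw [ENNReal.tsum_eq_iSup_nat, lt_iSup_iff] at h
    obtain ⟨K, hK⟩ := h
    induction K with
    | zero => simp at hK
    | succ K ih =>
      by_cases hlt : ENNReal.ofReal t < ∑ i ∈ Finset.range K, a i
      · exact ih hlt
      · -- The `K`-th period makes the difference, so that the tagged customer is present in it.
        have halive : (state b ξ n K ω).isSome := by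
          by_contra hn
          rw [Finset.sum_range_succ] at hK
          simp only [ha, hn] at hK hlt
          simp only [Bool.false_eq_true, if_false, add_zero] at hK
          exact hlt hK
        refine ⟨K, halive, ?_, ?_⟩
        · rcases K with _ | K
          · simpa [eventTime] using ht
          · rw [hsum K (isSome_state_of_le b ξ n ω K.le_succ halive), not_lt] at hlt
            exact (ENNReal.ofReal_le_ofReal_iff ht).1 hlt
        · rw [hsum K halive] at hK
          exact (ENNReal.ofReal_lt_ofReal_iff_of_nonneg ht).1 hK
  · rintro ⟨k, hk, -, hlt⟩
    calc ENNReal.ofReal t < ENNReal.ofReal (eventTime ξ (k + 1) ω) :=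
          (ENNReal.ofReal_lt_ofReal_iff_of_nonneg ht).2 hlt
      _ = ∑ i ∈ Finset.range (k + 1), a i := (hsum k hk).symm
      _ ≤ _ := ENNReal.sum_le_tsum _

variable [MeasurableSpace Ω]

/-- The state and the time of the `k`-th event are independent of the randomness used after it. -/
theorem indepFun_state_eventTime {ρ : ℝ} {P : Measure Ω} {ξ : ℕ → Ω → ℝ × ℝ × ℝ}
    (hξ : IsQueueInput ρ P ξ) (hm : ∀ k, Measurable (ξ k)) (b : ℕ → ℝ) (n k : ℕ) :
    IndepFun (fun ω => (state b ξ n k ω, eventTime ξ k ω)) (ξ k) P := by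
  set m : ℕ → MeasurableSpace Ω := fun i => MeasurableSpace.comap (ξ i) inferInstance with hmdef
  have h := indep_iSup_of_disjoint (m := m) (fun i => (hm i).comap_le) hξ.indep
    (S := {i | i < k}) (T := {k}) (by simp)
  rw [iSup_singleton] at h
  rw [IndepFun_iff_Indep]
  refine indep_of_indep_of_le_left h ?_
  have hle : ∀ i < k, Measurable[⨆ i ∈ {i | i < k}, m i] (ξ i) := fun i hi =>
    (comap_measurable (ξ i)).mono (le_iSup₂ (f := fun i (_ : i ∈ {i | i < k}) => m i) i hi) le_rfl
  exact (@measurable_state_eventTime Ω (⨆ i ∈ {i | i < k}, m i) b ξ n k hle).comap_le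

/-- Conditioning on the randomness used before the `k`-th event. -/
theorem lintegral_state_eventTime_input {ρ : ℝ} {P : Measure Ω} [IsProbabilityMeasure P]
    {ξ : ℕ → Ω → ℝ × ℝ × ℝ} (hξ : IsQueueInput ρ P ξ) (hm : ∀ k, Measurable (ξ k)) (b : ℕ → ℝ)
    (n k : ℕ) {G : (Option ℕ × ℝ) × (ℝ × ℝ × ℝ) → ℝ≥0∞} (hG : Measurable G) :
    ∫⁻ ω, G ((state b ξ n k ω, eventTime ξ k ω), ξ k ω) ∂P
      = ∫⁻ ω, ∫⁻ e, G ((state b ξ n k ω, eventTime ξ k ω), e) ∂eventLaw ρ ∂P := by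
  have hX : Measurable fun ω => (state b ξ n k ω, eventTime ξ k ω) :=
    measurable_state_eventTime b n k fun i _ => hm i
  have hlaw := (hξ.hasLaw k).map_eq
  have hprob : IsProbabilityMeasure (eventLaw ρ) := by
    rw [← hlaw]; exact Measure.isProbabilityMeasure_map (hm k).aemeasurable
  have h := (indepFun_iff_map_prod_eq_prod_map_map hX.aemeasurable (hm k).aemeasurable).1
    (indepFun_state_eventTime hξ hm b n k)
  rw [← lintegral_map (f := G) hG (hX.prodMk (hm k)), h, hlaw, lintegral_prod _ hG.aemeasurable,
    lintegral_map hG.lintegral_prod_right' hX]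

/-- Each event applies the transition operator to the state, and adds an independent exponential
time with parameter `1 + ρ` to the event time. -/
theorem lintegral_state_mul_poissonProb {ρ : ℝ} (hρ : 0 < ρ) {P : Measure Ω}
    [IsProbabilityMeasure P] {ξ : ℕ → Ω → ℝ × ℝ × ℝ} (hξ : IsQueueInput ρ P ξ)
    (hm : ∀ k, Measurable (ξ k)) {b : ℕ → ℝ} (hb0 : ∀ n, 0 ≤ b n) (hb1 : ∀ n, b n ≤ 1) (n k : ℕ)
    (f : ℕ → ℝ≥0∞) (t : ℝ) :
    ∫⁻ ω, (state b ξ n k ω).elim 0 f * poissonProb (1 + ρ) 0 (t - eventTime ξ k ω) ∂P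
      = (stepOpENN ρ b)^[k] f n * poissonProb (1 + ρ) k t := by
  have := isProbabilityMeasure_expMeasure (r := 1 + ρ) (by linarith)
  have hQ : ∀ k, Measurable (poissonProb (1 + ρ) k) := measurable_poissonProb (1 + ρ)
  have helim : ∀ g : ℕ → ℝ≥0∞, Measurable fun o : Option ℕ => o.elim 0 g := fun g =>
    Measurable.of_discrete
  induction k generalizing f t with
  | zero => simp [state, eventTime]
  | succ k ih =>
    have hst : Measurable (state b ξ n k) := measurable_state b n k fun i _ => hm i
    have het : Measurable (eventTime ξ k) := measurable_eventTime k fun i _ => hm i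
    have hG : Measurable fun p : (Option ℕ × ℝ) × (ℝ × ℝ × ℝ) =>
        (step b p.1.1 p.2).elim 0 f * poissonProb (1 + ρ) 0 (t - p.1.2 - wait p.2) := by
      refine Measurable.mul ((helim f).comp ((measurable_step_uncurry b).comp
        (measurable_fst.fst.prodMk measurable_snd))) ((hQ 0).comp ?_)
      exact (measurable_const.sub measurable_fst.snd).sub (measurable_wait.comp measurable_snd)
    have h1 := lintegral_state_eventTime_input hξ hm b n k hG
    simp only [eventTime_succ, state, ← sub_sub]
    rw [h1]
    have h2 : ∀ ω, ∫⁻ e, (step b (state b ξ n k ω) e).elim 0 f *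
          poissonProb (1 + ρ) 0 (t - eventTime ξ k ω - wait e) ∂eventLaw ρ
        = ∫⁻ r, (state b ξ n k ω).elim 0 (stepOpENN ρ b f) *
          poissonProb (1 + ρ) 0 (t - r - eventTime ξ k ω) ∂expMeasure (1 + ρ) := by
      intro ω
      have hh : Measurable fun r => poissonProb (1 + ρ) 0 (t - eventTime ξ k ω - r) :=
        (hQ 0).comp (measurable_const.sub measurable_id)
      rw [lintegral_step hρ hb0 hb1 f hh, ← lintegral_const_mul _ hh]
      simp only [sub_right_comm]
    simp only [h2]
    rw [lintegral_lintegral_swap]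
    · simp only [ih]
      have hQt : Measurable fun r => poissonProb (1 + ρ) k (t - r) :=
        (hQ k).comp (measurable_const.sub measurable_id)
      rw [lintegral_const_mul _ hQt,
        lintegral_poissonProb_sub (by linarith), ← Function.iterate_succ_apply]
    · refine (Measurable.mul ((helim _).comp (hst.comp measurable_fst))
        ((hQ 0).comp ?_)).aemeasurable
      exact (measurable_const.sub measurable_snd).sub (het.comp measurable_fst)

/-- The probability that the tagged customer is present during the period between the events `k`
and `k + 1`, and that this period contains `t`. -/
theorem measure_alive_at {ρ : ℝ} (hρ : 0 < ρ) {P : Measure Ω} [IsProbabilityMeasure P]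
    {ξ : ℕ → Ω → ℝ × ℝ × ℝ} (hξ : IsQueueInput ρ P ξ) (hm : ∀ k, Measurable (ξ k)) {b : ℕ → ℝ}
    (hb0 : ∀ n, 0 ≤ b n) (hb1 : ∀ n, b n ≤ 1) (n k : ℕ) (t : ℝ) :
    P {ω | (state b ξ n k ω).isSome ∧ eventTime ξ k ω ≤ t ∧ t < eventTime ξ (k + 1) ω}
      = (stepOpENN ρ b)^[k] (fun _ => 1) n * poissonProb (1 + ρ) k t := by
  set S : Set ((Option ℕ × ℝ) × (ℝ × ℝ × ℝ)) :=
    {p | p.1.1.isSome ∧ p.1.2 ≤ t ∧ t < p.1.2 + wait p.2} with hS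
  have hSm : MeasurableSet S := by
    refine MeasurableSet.inter (measurable_fst.fst (MeasurableSet.of_discrete
      (s := {o : Option ℕ | o.isSome}))) (MeasurableSet.inter
        (measurableSet_le measurable_fst.snd measurable_const) (measurableSet_lt measurable_const
          (measurable_fst.snd.add (measurable_wait.comp measurable_snd))))
  have hX : Measurable fun ω => ((state b ξ n k ω, eventTime ξ k ω), ξ k ω) :=
    (measurable_state_eventTime b n k fun i _ => hm i).prodMk (hm k)
  rw [← lintegral_state_mul_poissonProb hρ hξ hm hb0 hb1 n k (fun _ => 1) t]
  have e1 : {ω | (state b ξ n k ω).isSome ∧ eventTime ξ k ω ≤ t ∧ t < eventTime ξ (k + 1) ω}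
      = (fun ω => ((state b ξ n k ω, eventTime ξ k ω), ξ k ω)) ⁻¹' S := by
    simp only [eventTime_succ]
    rfl
  rw [e1, ← lintegral_indicator_one (hX hSm)]
  have h := lintegral_state_eventTime_input hξ hm b n k
    (measurable_one.indicator hSm :
      Measurable (S.indicator (1 : (Option ℕ × ℝ) × (ℝ × ℝ × ℝ) → ℝ≥0∞)))
  refine Eq.trans h (lintegral_congr fun ω => ?_)
  rw [← ite_expMeasure_Ioi (by linarith)]
  generalize state b ξ n k ω = o
  generalize eventTime ξ k ω = s
  have e2 : ∀ e, S.indicator (1 : (Option ℕ × ℝ) × (ℝ × ℝ × ℝ) → ℝ≥0∞) ((o, s), e)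
      = (o.elim 0 (fun _ => 1) * if s ≤ t then 1 else 0) *
        (Ioi (t - s)).indicator (fun _ => 1) (wait e) := by
    intro e
    rcases o with _ | j
    · simp [hS]
    · by_cases hs : s ≤ t
      · simp [hS, indicator, hs, sub_lt_iff_lt_add']
      · simp [hS, indicator, hs]
  simp only [e2]
  have hind : Measurable ((Ioi (t - s)).indicator (fun _ => (1 : ℝ≥0∞))) :=
    measurable_const.indicator measurableSet_Ioi
  have hindw : Measurable fun e => (Ioi (t - s)).indicator (fun _ => (1 : ℝ≥0∞)) (wait e) :=
    hind.comp measurable_wait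
  rw [lintegral_const_mul _ hindw, lintegral_wait hρ hind,
    lintegral_indicator_const measurableSet_Ioi, mul_assoc]
  simp

/-- The tail for an input that is measurable and nonnegative everywhere. -/
theorem measure_lt_sojournTime {ρ : ℝ} (hρ : 0 < ρ) {P : Measure Ω} [IsProbabilityMeasure P]
    {ξ : ℕ → Ω → ℝ × ℝ × ℝ} (hξ : IsQueueInput ρ P ξ) (hm : ∀ k, Measurable (ξ k))
    (hw : ∀ k ω, 0 ≤ wait (ξ k ω)) {b : ℕ → ℝ} (hb0 : ∀ n, 0 ≤ b n) (hb1 : ∀ n, b n ≤ 1) (n : ℕ)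
    {t : ℝ} (ht : 0 ≤ t) :
    P {ω | ENNReal.ofReal t < sojournTime b ξ n ω}
      = ENNReal.ofReal (Real.exp (-((1 + ρ) * t)) *
        ∑' k : ℕ, (stepOp ρ b)^[k] (fun _ => 1) n * (((1 + ρ) * t) ^ k / k !)) := by
  have hset : {ω | ENNReal.ofReal t < sojournTime b ξ n ω} = ⋃ k, {ω | (state b ξ n k ω).isSome ∧
      eventTime ξ k ω ≤ t ∧ t < eventTime ξ (k + 1) ω} := by
    ext ω
    simp only [mem_iUnion]
    exact lt_sojournTime_iff b n (fun k => hw k ω) ht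
  have hmono : ∀ ω, Monotone fun k => eventTime ξ k ω := fun ω =>
    monotone_nat_of_le_succ fun k => by
      rw [eventTime_succ]
      linarith [hw k ω]
  have hst : ∀ k, Measurable (state b ξ n k) := fun k => measurable_state b n k fun i _ => hm i
  have het : ∀ k, Measurable (eventTime ξ k) := fun k => measurable_eventTime k fun i _ => hm i
  rw [hset, measure_iUnion]
  · simp only [measure_alive_at hρ hξ hm hb0 hb1]
    have hv := ofReal_iterate_stepOp_one hρ hb0 hb1
    have hterm : ∀ k : ℕ, (stepOpENN ρ b)^[k] (fun _ => 1) n * poissonProb (1 + ρ) k t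
        = ENNReal.ofReal (Real.exp (-((1 + ρ) * t)) *
          ((stepOp ρ b)^[k] (fun _ => 1) n * (((1 + ρ) * t) ^ k / k !))) := by
      intro k
      rw [(hv k n).2, poissonProb, if_pos ht, ← ENNReal.ofReal_mul (hv k n).1]
      congr 1
      ring
    simp only [hterm]
    rw [← tsum_mul_left, ENNReal.ofReal_tsum_of_nonneg]
    · intro k
      have := (hv k n).1
      positivity
    · exact (summable_mul_pow_div_factorial (fun k =>
        abs_iterate_stepOp_le hρ hb0 hb1 (f := fun _ => 1) (C := 1) (by simp) k n) _).mul_left _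
  · intro i j hij
    refine Set.disjoint_left.2 fun ω hi hj => ?_
    rcases lt_or_gt_of_ne hij with h | h
    · exact absurd hi.2.2 (not_lt.2 ((hmono ω h).trans hj.2.1))
    · exact absurd hj.2.2 (not_lt.2 ((hmono ω h).trans hi.2.1))
  · intro k
    exact MeasurableSet.inter (hst k (MeasurableSet.of_discrete (s := {o : Option ℕ | o.isSome})))
      (MeasurableSet.inter (measurableSet_le (het k) measurable_const)
        (measurableSet_lt measurable_const (het (k + 1))))

theorem ae_eventLaw_wait_nonneg {ρ : ℝ} (hρ : 0 < ρ) : ∀ᵐ e ∂eventLaw ρ, 0 ≤ wait e := by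
  have hS : MeasurableSet (Iio (0 : ℝ)) := measurableSet_Iio
  have h := lintegral_wait hρ (h := (Iio (0 : ℝ)).indicator 1) (measurable_one.indicator hS)
  rw [lintegral_indicator_one hS, expMeasure_Iio_zero (by linarith)] at h
  have hm : Measurable fun e => (Iio (0 : ℝ)).indicator (1 : ℝ → ℝ≥0∞) (wait e) :=
    (measurable_one.indicator hS).comp measurable_wait
  rw [lintegral_eq_zero_iff hm] at h
  filter_upwards [h] with e he
  by_contra hn
  simp [indicator, not_le.1 hn] at he

theorem IsQueueInput.congr {ρ : ℝ} {P : Measure Ω} {ξ ξ' : ℕ → Ω → ℝ × ℝ × ℝ}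
    (hξ : IsQueueInput ρ P ξ) (h : ∀ k, ξ k =ᵐ[P] ξ' k) : IsQueueInput ρ P ξ' :=
  ⟨fun k => (hξ.hasLaw k).congr (h k).symm, hξ.indep.congr h⟩

/-- An input can be modified on a null set to become measurable and nonnegative. -/
theorem IsQueueInput.exists_measurable {ρ : ℝ} (hρ : 0 < ρ) {P : Measure Ω}
    {ξ : ℕ → Ω → ℝ × ℝ × ℝ} (hξ : IsQueueInput ρ P ξ) :
    ∃ ξ' : ℕ → Ω → ℝ × ℝ × ℝ, (∀ k, ξ k =ᵐ[P] ξ' k) ∧ (∀ k, Measurable (ξ' k)) ∧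
      ∀ k ω, 0 ≤ wait (ξ' k ω) := by
  classical
  have hS : MeasurableSet {e : ℝ × ℝ × ℝ | 0 ≤ wait e} :=
    measurableSet_le measurable_const measurable_wait
  set η : ℕ → Ω → ℝ × ℝ × ℝ := fun k => (hξ.hasLaw k).aemeasurable.mk (ξ k) with hη
  have hηm : ∀ k, Measurable (η k) := fun k => (hξ.hasLaw k).aemeasurable.measurable_mk
  refine ⟨fun k ω => if 0 ≤ wait (η k ω) then η k ω else 0, fun k => ?_, fun k => ?_, ?_⟩
  · have h0 : ∀ᵐ ω ∂P, 0 ≤ wait (ξ k ω) :=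
      ((hξ.hasLaw k).ae_iff (measurableSet_setOfPred.1 hS)).2 (ae_eventLaw_wait_nonneg hρ)
    filter_upwards [h0, (hξ.hasLaw k).aemeasurable.ae_eq_mk] with ω h0 h1
    have h2 : ξ k ω = η k ω := h1
    rw [h2] at h0
    rw [if_pos h0, h2]
  · exact Measurable.ite (hηm k hS) (hηm k) measurable_const
  · intro k ω
    dsimp only
    split_ifs with h
    · exact h
    · simp [wait]

theorem sojournTail_eq {ρ : ℝ} (hρ : 0 < ρ) {P : Measure Ω} [IsProbabilityMeasure P]
    {ξ : ℕ → Ω → ℝ × ℝ × ℝ} (hξ : IsQueueInput ρ P ξ) {b : ℕ → ℝ} (hb0 : ∀ n, 0 ≤ b n)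
    (hb1 : ∀ n, b n ≤ 1) (n : ℕ) {t : ℝ} (ht : 0 ≤ t) :
    sojournTail P b ξ n t = Real.exp (-((1 + ρ) * t)) *
        ∑' k : ℕ, (stepOp ρ b)^[k] (fun _ => 1) n * (((1 + ρ) * t) ^ k / k !) := by
  obtain ⟨ξ', hae, hm, hw⟩ := hξ.exists_measurable hρ
  have hS : ∀ᵐ ω ∂P, sojournTime b ξ n ω = sojournTime b ξ' n ω := by
    filter_upwards [ae_all_iff.2 hae] with ω h
    have hst : ∀ k, state b ξ n k ω = state b ξ' n k ω := by
      intro k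
      induction k with
      | zero => rfl
      | succ k ih => rw [state, state, ih, h k]
    simp only [sojournTime, hst, h]
  have hP : P {ω | ENNReal.ofReal t < sojournTime b ξ n ω}
      = P {ω | ENNReal.ofReal t < sojournTime b ξ' n ω} := by
    refine measure_congr ?_
    filter_upwards [hS] with ω h
    exact congrArg (ENNReal.ofReal t < ·) h
  rw [sojournTail, measureReal_def, hP,
    measure_lt_sojournTime hρ (hξ.congr hae) hm hw hb0 hb1 n ht, ENNReal.toReal_ofReal]
  refine mul_nonneg (Real.exp_pos _).le (tsum_nonneg fun k => mul_nonneg ?_ (by positivity))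
  exact (ofReal_iterate_stepOp_one hρ hb0 hb1 k n).1

end

end BalkingPS

theorem theorem2p1 {Ω : Type*} [MeasurableSpace Ω] (P : Measure Ω) [IsProbabilityMeasure P]
    (ρ : ℝ) (hρ : 0 < ρ) (ξ : ℕ → Ω → ℝ × ℝ × ℝ) (hξ : BalkingPS.IsQueueInput ρ P ξ)
    (n : ℕ) (t : ℝ) (ht : 0 ≤ t) :
    DifferentiableWithinAt ℝ (BalkingPS.sojournTail P BalkingPS.joinProb ξ n) (Ici 0) t ∧
    Summable (fun m : ℕ =>
      BalkingPS.spectralTerm ρ n t (m + 1) (BalkingPS.nu ρ (m + 1))) ∧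
    Summable (fun m : ℕ =>
      BalkingPS.spectralTerm ρ n t (m + 1) (BalkingPS.nuTilde ρ (m + 1))) ∧
    BalkingPS.sojournDensity P BalkingPS.joinProb ξ n t =
      (∑' m : ℕ, BalkingPS.spectralTerm ρ n t (m + 1) (BalkingPS.nu ρ (m + 1))) +
      ∑' m : ℕ, BalkingPS.spectralTerm ρ n t (m + 1) (BalkingPS.nuTilde ρ (m + 1)) :=
  BalkingPS.density_of_tail hρ
    (fun _ hs => BalkingPS.sojournTail_eq hρ hξ BalkingPS.joinProb_nonneg
      BalkingPS.joinProb_le_one n hs) ht
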